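/- Let $G=\mathbb{C}^*$ act linearly (i.e. by an algebraic representation) on a finite-dimensional complex vector space $V$, with associated weight space decomposition $V=\bigoplus_{m\in\mathbb{Z}}V_m$, where $V_m=\{v\in V : t\cdot v=t^m v \text{ for all } t\in\mathbb{C}^*\}$. Let $$p\colon V\longrightarrow S:=V/\!/\mathbb{C}^*=\operatorname{Spec}\bigl(\operatorname{Sym}(V^*)^{\mathbb{C}^*}\bigr)$$ be the GIT quotient, put $s_0:=p(0)\in S$, and let $S^{\mathrm{sing}}\subseteq S$ denote the singular locus of $S$. Suppose that $V_{-1}$ and $V_1$ both have dimension $\geq 2$. Then: (i) The quotient $S$ is singular in $s_0$. (ii) Every neighbourhood $U$ of $s_0$ in the set of closed points of $S$, taken with the Euclidean topology, contains an open neighbourhood $U'\subseteq U$ of $s_0$ such that $U'\setminus S^{\mathrm{sing}}$ is connected and $\pi_1(U'\setminus S^{\mathrm{sing}})$ is trivial. -/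

import Mathlib

noncomputable section

namespace GITQuotient

/-! ### Linear actions of an abstract group and their affine quotients -/

section Quotient

variable {G V : Type*} [Group G] [AddCommGroup V] [Module ℂ V]

/-- The action of `g` on the algebra `Sym(V^*)` of polynomial functions on `V`: the algebra
endomorphism that extends the contragredient action `φ ↦ φ ∘ ρ(g⁻¹)` on the generators `V^*`. -/
def symAction (ρ : Representation ℂ G V) (g : G) :
    SymmetricAlgebra ℂ (Module.Dual ℂ V) →ₐ[ℂ] SymmetricAlgebra ℂ (Module.Dual ℂ V) :=
  SymmetricAlgebra.lift (SymmetricAlgebra.ι ℂ (Module.Dual ℂ V) ∘ₗ ρ.dual g)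

/-- The algebra of invariants `Sym(V^*)^G`, i.e. the coordinate ring of `V // G`. -/
def invariantRing (ρ : Representation ℂ G V) :
    Subalgebra ℂ (SymmetricAlgebra ℂ (Module.Dual ℂ V)) :=
  ⨅ g : G, AlgHom.equalizer (symAction ρ g) (AlgHom.id ℂ _)

/-- Evaluation of polynomial functions at a vector `v`. -/
def evalAt (v : V) : SymmetricAlgebra ℂ (Module.Dual ℂ V) →ₐ[ℂ] ℂ :=
  SymmetricAlgebra.lift (Module.Dual.eval ℂ V v)

end Quotient

/-! ### Complex points of an affine scheme over `ℂ` -/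

section Points

variable (A : Type*) [CommRing A] [Algebra ℂ A]

/-- The complex points of `Spec A`; if `A` is of finite type over `ℂ`, these are its closed
points. -/
def ComplexPoints : Type _ := A →ₐ[ℂ] ℂ

/-- The Euclidean topology: the coarsest topology for which every regular function is continuous.
If `A` is generated by `f₁, …, f_N`, this is the topology induced by the closed embedding
`(f₁, …, f_N)` into `ℂ^N`. -/
instance : TopologicalSpace (ComplexPoints A) :=
  TopologicalSpace.induced (fun (x : A →ₐ[ℂ] ℂ) (a : A) => x a) inferInstance

variable {A}

/-- The point of the underlying space of `Spec A` given by a complex point. -/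
def ComplexPoints.toPrimeSpectrum (x : ComplexPoints A) : PrimeSpectrum A :=
  ⟨RingHom.ker (show A →ₐ[ℂ] ℂ from x), RingHom.ker_isPrime _⟩

variable (A)

/-- The singular locus, as a set of complex points: the points at which the local ring of `Spec A`
is not regular. -/
def singularLocus : Set (ComplexPoints A) :=
  {x | ¬ IsRegularLocalRing (Localization.AtPrime x.toPrimeSpectrum.asIdeal)}

end Points

/-- The space of closed points of `V // G = Spec (Sym(V^*)^G)`, with the Euclidean topology. -/
abbrev AffineQuotient {G V : Type*} [Group G] [AddCommGroup V] [Module ℂ V]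
    (ρ : Representation ℂ G V) : Type _ :=
  ComplexPoints (invariantRing ρ)

/-- The quotient map `p : V → V // G`. -/
def quotientMap {G V : Type*} [Group G] [AddCommGroup V] [Module ℂ V]
    (ρ : Representation ℂ G V) (v : V) : AffineQuotient ρ :=
  (evalAt v).comp (invariantRing ρ).val

/-! ### Algebraic representations of `ℂ^*` -/

section Torus

variable {V : Type*} [AddCommGroup V] [Module ℂ V]

/-- A linear action of `ℂ^*` is algebraic if all its matrix coefficients are regular functions on
`ℂ^*`, i.e. Laurent polynomials. -/
def IsAlgebraicRep (ρ : Representation ℂ ℂˣ V) : Prop :=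
  ∀ (φ : Module.Dual ℂ V) (v : V), ∃ P : LaurentPolynomial ℂ, ∀ t : ℂˣ,
    φ (ρ t v) = LaurentPolynomial.eval₂ (RingHom.id ℂ) t P

/-- The weight space `V_m`, on which `t ∈ ℂ^*` acts as `t ^ m`. -/
def weightSpace (ρ : Representation ℂ ℂˣ V) (m : ℤ) : Submodule ℂ V :=
  ⨅ t : ℂˣ, LinearMap.eqLocus (ρ t) (((t ^ m : ℂˣ) : ℂ) • LinearMap.id)

end Torus

end GITQuotient

end

/-! In coordinates adapted to a weight basis, with weights `a : σ → ℤ`, the invariants are spanned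
by the monomials of weight zero, and every complex point of S is the image of some v in ℂ^σ
(`evalPoint_surjective`). The key fact is that the regular points of S are exactly the images of the
free locus: the points v whose nonzero coordinates have weights of both signs and with greatest
common divisor one, that is, with closed orbit and trivial stabilizer.

Singular points. The dimension of S is at most |σ| - 1, and at a regular point there are at most as
many independent point derivations as the dimension (`card_le_of_notMem_singularLocus`). Every point
outside the free image has a representative v with generic stabilizer order k ≠ 1, where k = 0 means
a fixed point. All coordinates of weight 1 and -1 then vanish at v, and the four products of the X_α
with the X_β cannot be split into factors of weight divisible by k. Together with one indecomposable
exponent for each other vanishing coordinate and the logarithmic derivatives along the support, they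
give |σ| independent point derivations, one too many
(`evalPoint_mem_singularLocus_of_isStabilizerOrder`). The model case is weights 1, 1, -1, -1, where
S is the cone xy = zw. The case v = 0 is assertion (i).

Regular points. At a free point there are monomials of weights 1 and -1 that do not vanish. The
slice on which the first equals one provides a section of the quotient map over the local ring, from
which regularity follows (`evalPoint_notMem_singularLocus`).

Simple connectedness. A polydisc U' in the invariant monomials has a star-shaped preimage in ℂ^σ.
The complement of the free locus is a finite union of coordinate subspaces of complex codimension at
least two, so the free points over U' form a simply connected space by general position
(`simplyConnectedSpace_starConvex_diff`). They map onto U' minus the singular locus with local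
sections and with ℂˣ-orbits as fibres. Paths therefore lift, the fibres are path connected, and
simple connectedness descends (`SimplyConnectedSpace.of_local_sections`). -/

section

open Topology unitInterval

/-! ### Descending simple connectedness along maps with local sections -/

section Descent

variable {E B : Type*} [TopologicalSpace E] [TopologicalSpace B]

/-- Path lifting for a map that has, over a neighbourhood of each point, sections through
every point. -/
theorem exists_continuous_lift_of_local_sections {q : E → B}
    (hsec : ∀ b : B, ∃ O ∈ 𝓝 b, ∀ e : E, q e ∈ O →
      ∃ s : B → E, ContinuousOn s O ∧ (∀ y ∈ O, q (s y) = y) ∧ s (q e) = e)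
    (γ : C(I, B)) (e₀ : E) (he₀ : q e₀ = γ 0) :
    ∃ Γ : C(I, E), Γ 0 = e₀ ∧ ∀ t, q (Γ t) = γ t := by
  choose O hO hs using hsec
  obtain ⟨t, ht0, htm, ⟨N, hN⟩, hsub⟩ := exists_monotone_Icc_subset_open_cover_unitInterval
    (c := fun b : B => γ ⁻¹' interior (O b)) (fun b => isOpen_interior.preimage γ.continuous)
    (fun x _ => Set.mem_iUnion.2 ⟨γ x, mem_interior_iff_mem_nhds.2 (hO _)⟩)
  -- A lift over `[0, t n]` is prolonged by composing `γ` with the section through the endpoint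
  -- already reached.
  have key : ∀ n, ∃ Γ : I → E, ContinuousOn Γ (Set.Icc 0 (t n)) ∧ Γ 0 = e₀ ∧
      ∀ x ∈ Set.Icc 0 (t n), q (Γ x) = γ x := by
    intro n
    induction n with
    | zero =>
      refine ⟨fun _ => e₀, continuousOn_const, rfl, ?_⟩
      rintro x ⟨_, hx⟩
      rw [ht0] at hx
      rw [le_antisymm hx x.2.1, he₀]
    | succ n ih =>
      obtain ⟨Γ, hΓ, hΓ0, hΓq⟩ := ih
      obtain ⟨b, hb⟩ := hsub n
      have hmem : ∀ x ∈ Set.Icc (t n) (t (n + 1)), γ x ∈ O b := fun x hx =>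
        interior_subset (hb hx)
      have htn : t n ∈ Set.Icc (t n) (t (n + 1)) := ⟨le_rfl, htm n.le_succ⟩
      have hq : q (Γ (t n)) = γ (t n) := hΓq _ ⟨(t n).2.1, le_rfl⟩
      obtain ⟨s, hsc, hsq, hse⟩ := hs b (Γ (t n)) (by rw [hq]; exact hmem _ htn)
      classical
      refine ⟨fun x => if x ≤ t n then Γ x else s (γ x), ?_, ?_, ?_⟩
      · have h2 : ContinuousOn (fun x => s (γ x)) (Set.Icc (t n) (t (n + 1))) :=
          hsc.comp γ.continuous.continuousOn hmem
        have hun : Set.Icc 0 (t (n + 1)) ⊆ Set.Icc 0 (t n) ∪ Set.Icc (t n) (t (n + 1)) := by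
          intro x hx
          rcases le_total x (t n) with h | h
          · exact Or.inl ⟨hx.1, h⟩
          · exact Or.inr ⟨h, hx.2⟩
        refine ContinuousOn.mono ?_ hun
        refine ContinuousOn.union_of_isClosed ?_ ?_ isClosed_Icc isClosed_Icc
        · exact hΓ.congr fun x hx => if_pos hx.2
        · refine h2.congr fun x hx => ?_
          by_cases h : x ≤ t n
          · have : x = t n := le_antisymm h hx.1
            subst this
            simp [← hq, hse]
          · exact if_neg h
      · have h0 : (0 : I) ≤ t n := (t n).2.1
        simp [h0, hΓ0]
      · intro x hx
        by_cases h : x ≤ t n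
        · simpa [h] using hΓq x ⟨hx.1, h⟩
        · simpa [h] using hsq _ (hmem x ⟨(not_le.1 h).le, hx.2⟩)
  obtain ⟨Γ, hΓ, hΓ0, hΓq⟩ := key N
  have huniv : Set.Icc 0 (t N) = Set.univ := by
    rw [hN N le_rfl]
    exact Set.eq_univ_of_forall fun x => ⟨x.2.1, x.2.2⟩
  rw [huniv] at hΓ hΓq
  exact ⟨⟨Γ, continuousOn_univ.1 hΓ⟩, hΓ0, fun x => hΓq x trivial⟩

/-- Needed because the lifted paths project to paths whose endpoint equals `y` only propositionally.
-/
theorem Path.Homotopic.of_cast_trans_refl {X : Type*} [TopologicalSpace X] {x y y' y'' : X}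
    {γ₁ γ₂ : Path x y} (h' : y' = y) (h'' : y'' = y)
    (h : Path.Homotopic ((γ₁.cast rfl h').trans ((Path.refl y).cast h' h'')) (γ₂.cast rfl h'')) :
    Path.Homotopic γ₁ γ₂ := by
  subst h'
  subst h''
  exact (show Path.Homotopic γ₁ (γ₁.trans (Path.refl _)) from
    ⟨(Path.Homotopy.transRefl γ₁).symm⟩).trans h

/-- Simple connectedness descends along a map with local sections and path connected fibres. -/
theorem SimplyConnectedSpace.of_local_sections [SimplyConnectedSpace E] {q : E → B}
    (hq : Continuous q) (hsurj : Function.Surjective q)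
    (hsec : ∀ b : B, ∃ O ∈ 𝓝 b, ∀ e : E, q e ∈ O →
      ∃ s : B → E, ContinuousOn s O ∧ (∀ y ∈ O, q (s y) = y) ∧ s (q e) = e)
    (hfib : ∀ e e' : E, q e = q e' → ∃ γ : Path e e', ∀ t, q (γ t) = q e) :
    SimplyConnectedSpace B := by
  rw [simply_connected_iff_paths_homotopic']
  refine ⟨hsurj.pathConnectedSpace hq, ?_⟩
  intro x y γ₁ γ₂
  obtain ⟨e, rfl⟩ := hsurj x
  obtain ⟨Γ₁, h₁0, h₁⟩ := exists_continuous_lift_of_local_sections hsec γ₁.toContinuousMap e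
    (by simp)
  obtain ⟨Γ₂, h₂0, h₂⟩ := exists_continuous_lift_of_local_sections hsec γ₂.toContinuousMap e
    (by simp)
  -- The two lifts may end at different points of one fibre; `β` joins these inside the fibre and
  -- hence projects to a constant path.
  obtain ⟨β, hβ⟩ := hfib (Γ₁ 1) (Γ₂ 1) (by rw [h₁, h₂]; simp)
  let P₁ : Path e (Γ₁ 1) := ⟨Γ₁, h₁0, rfl⟩
  let P₂ : Path e (Γ₂ 1) := ⟨Γ₂, h₂0, rfl⟩
  have hy₁ : q (Γ₁ 1) = y := by rw [h₁]; simp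
  have hy₂ : q (Γ₂ 1) = y := by rw [h₂]; simp
  have hom : Path.Homotopic (P₁.trans β) P₂ := SimplyConnectedSpace.paths_homotopic _ _
  have hom' := hom.map ⟨q, hq⟩
  rw [Path.map_trans] at hom'
  have e₁ : P₁.map hq = γ₁.cast rfl hy₁ := by
    ext t; exact h₁ t
  have e₂ : P₂.map hq = γ₂.cast rfl hy₂ := by
    ext t; exact h₂ t
  have e₃ : β.map hq = (Path.refl y).cast hy₁ hy₂ := by
    ext t; simpa [hy₁] using hβ t
  have h : Path.Homotopic ((P₁.map hq).trans (β.map hq)) (P₂.map hq) := hom'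
  rw [e₁, e₂, e₃] at h
  exact h.of_cast_trans_refl hy₁ hy₂

end Descent

end

section

open Topology unitInterval

/-! ### Complements of subspaces of real codimension at least three -/

section Complement

variable {F : Type*} [NormedAddCommGroup F] [NormedSpace ℝ F]

/-- A continuous path in a normed space is uniformly close to a smooth one with the same ends. -/
theorem exists_contDiff_path_near {γ : ℝ → F} (hγ : Continuous γ) {ε : ℝ} (hε : 0 < ε) :
    ∃ g : ℝ → F, ContDiff ℝ 1 g ∧ g 0 = γ 0 ∧ g 1 = γ 1 ∧
      ∀ t ∈ Set.Icc (0 : ℝ) 1, dist (g t) (γ t) < ε := by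
  obtain ⟨g, hg⟩ := exists_contMDiffMap_forall_mem_convex_of_local_const (n := 1)
    (modelWithCornersSelf ℝ ℝ) (t := fun x : ℝ => Metric.ball (γ x) (ε / 4))
    (fun x => convex_ball _ _) (fun x => ⟨γ x, by
      have := (hγ.tendsto x).eventually (Metric.ball_mem_nhds (γ x) (show 0 < ε / 4 by linarith))
      filter_upwards [this] with y hy
      rwa [Metric.mem_ball, dist_comm]⟩)
  have hgd : ContDiff ℝ 1 g := g.contMDiff.contDiff
  -- The affine correction restores the endpoints; it adds two errors of at most ε/4 to the one
  -- already present.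
  refine ⟨fun t => g t + (1 - t) • (γ 0 - g 0) + t • (γ 1 - g 1), by fun_prop, by simp, by simp,
    fun t ht => ?_⟩
  have h (x : ℝ) : ‖γ x - g x‖ < ε / 4 := by
    simpa [dist_eq_norm, norm_sub_rev] using hg x
  have h0 : ‖(1 - t) • (γ 0 - g 0)‖ ≤ ε / 4 := by
    rw [norm_smul, Real.norm_of_nonneg (by linarith [ht.2])]
    nlinarith [h 0, norm_nonneg (γ 0 - g 0), ht.1, ht.2]
  have h1 : ‖t • (γ 1 - g 1)‖ ≤ ε / 4 := by
    rw [norm_smul, Real.norm_of_nonneg ht.1]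
    nlinarith [h 1, norm_nonneg (γ 1 - g 1), ht.1, ht.2]
  have h2 := h t
  rw [dist_eq_norm]
  calc ‖g t + (1 - t) • (γ 0 - g 0) + t • (γ 1 - g 1) - γ t‖
      = ‖(1 - t) • (γ 0 - g 0) + t • (γ 1 - g 1) - (γ t - g t)‖ := by congr 1; abel
    _ ≤ ‖(1 - t) • (γ 0 - g 0)‖ + ‖t • (γ 1 - g 1)‖ + ‖γ t - g t‖ :=
        (norm_sub_le _ _).trans (by gcongr; exact norm_add_le _ _)
    _ < ε := by linarith

/-- The vertices `q` for which the cone over the curve `g` with vertex `q` meets `L` form a set of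
small Hausdorff dimension. -/
theorem dimH_cone_vertices_le [FiniteDimensional ℝ F] {g : ℝ → F} (hg : ContDiff ℝ 1 g) (L : Submodule ℝ F) :
    dimH {q : F | ∃ t s : ℝ, s ≠ 0 ∧ (1 - s) • g t + s • q ∈ L} ≤
      ((Module.finrank ℝ L + 2 : ℕ) : ENNReal) := by
  -- Solving for the vertex gives q = s⁻¹ l - (s⁻¹ - 1) g(t) with l in `L`. The first parameter is
  -- s⁻¹, so that no inverse enters `f` and the map is C¹ everywhere.
  let f : ℝ × ℝ × L → F := fun z => (z.2.2 : F) - (z.1 - 1) • g z.2.1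
  have hf : ContDiff ℝ 1 f := by
    have : ContDiff ℝ 1 fun z : ℝ × ℝ × L => (z.2.2 : F) :=
      L.subtypeL.contDiff.comp (contDiff_snd.comp contDiff_snd)
    fun_prop
  refine (dimH_mono ?_).trans (hf.dimH_range_le.trans ?_)
  · rintro q ⟨t, s, hs, hq⟩
    refine ⟨(s⁻¹, t, ⟨s⁻¹ • ((1 - s) • g t + s • q), L.smul_mem _ hq⟩), ?_⟩
    simp only [f, smul_add, smul_smul, inv_mul_cancel₀ hs, one_smul]
    rw [show s⁻¹ * (1 - s) = s⁻¹ - 1 by field_simp]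
    abel
  · have : Module.finrank ℝ (ℝ × ℝ × L) = Module.finrank ℝ L + 2 := by
      simp [Module.finrank_prod]; ring
    rw [this]

/-- A homotopy of paths in a subset given by a continuous map on the plane. -/
theorem Path.Homotopic.of_continuous_plane {X : Type*} [TopologicalSpace X] {W : Set X} {x y : W}
    {γ₁ γ₂ : Path x y} (f : ℝ → ℝ → X) (hf : Continuous fun z : ℝ × ℝ => f z.1 z.2)
    (hW : ∀ s ∈ I, ∀ t ∈ I, f s t ∈ W)
    (h₁ : ∀ t : I, f 0 t = γ₁ t) (h₂ : ∀ t : I, f 1 t = γ₂ t)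
    (hx : ∀ s ∈ I, f s 0 = x) (hy : ∀ s ∈ I, f s 1 = y) : Path.Homotopic γ₁ γ₂ := by
  have hc : Continuous fun z : I × I => (⟨f z.1 z.2, hW _ z.1.2 _ z.2.2⟩ : W) :=
    Continuous.subtype_mk (hf.comp
      (by fun_prop : Continuous fun z : I × I => ((z.1 : ℝ), (z.2 : ℝ)))) _
  refine ⟨⟨⟨⟨fun z => ⟨f z.1 z.2, hW _ z.1.2 _ z.2.2⟩, hc⟩, ?_, ?_⟩, ?_⟩⟩
  · exact fun t => Subtype.ext (h₁ t)
  · exact fun t => Subtype.ext (h₂ t)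
  · rintro s t (rfl | rfl)
    · exact Subtype.ext (by simpa using hx s s.2)
    · exact Subtype.ext (by simpa using hy s s.2)

variable [FiniteDimensional ℝ F] {ι : Type*} [Countable ι] {L : ι → Submodule ℝ F} {Ω : Set F}

/-- Two smooth curves in a star-shaped open set that avoid subspaces of codimension at least
three can be coned off from a common vertex inside the complement of these subspaces. -/
theorem exists_common_cone_vertex (hL : ∀ i, Module.finrank ℝ (L i) + 3 ≤ Module.finrank ℝ F)
    (hΩ : IsOpen Ω) (hstar : StarConvex ℝ 0 Ω)
    {g₁ g₂ : ℝ → F} (hg₁ : ContDiff ℝ 1 g₁) (hg₂ : ContDiff ℝ 1 g₂)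
    (h₁ : ∀ t ∈ I, g₁ t ∈ Ω) (h₂ : ∀ t ∈ I, g₂ t ∈ Ω) :
    ∃ q : F, ∀ t ∈ I, ∀ s ∈ I, s ≠ 0 →
      (1 - s) • g₁ t + s • q ∈ Ω \ ⋃ i, (L i : Set F) ∧
      (1 - s) • g₂ t + s • q ∈ Ω \ ⋃ i, (L i : Set F) := by
  let bad (g : ℝ → F) (i : ι) : Set F := {q : F | ∃ t s : ℝ, s ≠ 0 ∧ (1 - s) • g t + s • q ∈ L i}
  have hbad {g : ℝ → F} (hg : ContDiff ℝ 1 g) (i : ι) :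
      dimH (bad g i) ≤ ((Module.finrank ℝ F - 1 : ℕ) : ENNReal) :=
    (dimH_cone_vertices_le hg (L i)).trans (by exact_mod_cast (by have := hL i; omega))
  have hdense : Dense (⋃ i, (bad g₁ i ∪ bad g₂ i))ᶜ := by
    -- An index is needed for the strict inequality: without one, `hL` does not exclude dimension
    -- zero.
    rcases isEmpty_or_nonempty ι with hι | ⟨⟨i₀⟩⟩
    · simp
    refine dense_compl_of_dimH_lt_finrank ?_
    refine lt_of_le_of_lt (b := ((Module.finrank ℝ F - 1 : ℕ) : ENNReal)) ?_ ?_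
    · rw [dimH_iUnion]
      refine iSup_le fun i => ?_
      rw [dimH_union]
      exact max_le (hbad hg₁ i) (hbad hg₂ i)
    · have := hL i₀
      exact_mod_cast (by omega)
  -- The cone over the curve with vertex 0 is compact and lies in `Ω` by star-shapedness, so a
  -- vertex close enough to 0 also works.
  have hcomp {g : ℝ → F} (hg : ContDiff ℝ 1 g) (h : ∀ t ∈ I, g t ∈ Ω) :
      ∃ δ > 0, ∀ q : F, ‖q‖ < δ → ∀ t ∈ I, ∀ s ∈ I, (1 - s) • g t + s • q ∈ Ω := by
    let K : Set F := (fun z : ℝ × ℝ => (1 - z.1) • g z.2) '' (I ×ˢ I)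
    have hK : IsCompact K := by
      refine (isCompact_Icc.prod isCompact_Icc).image ?_
      have := hg.continuous
      fun_prop
    have hKΩ : K ⊆ Ω := by
      rintro _ ⟨⟨s, t⟩, ⟨hs, ht⟩, rfl⟩
      have := hstar (h t ht) (a := s) (b := 1 - s) hs.1 (by linarith [hs.2]) (by ring)
      simpa using this
    obtain ⟨δ, hδ, hsub⟩ := hK.exists_thickening_subset_open hΩ hKΩ
    refine ⟨δ, hδ, fun q hq t ht s hs => hsub ?_⟩
    rw [Metric.mem_thickening_iff]
    refine ⟨(1 - s) • g t, ⟨(s, t), ⟨hs, ht⟩, rfl⟩, ?_⟩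
    rw [dist_eq_norm, add_sub_cancel_left, norm_smul, Real.norm_of_nonneg hs.1]
    nlinarith [hs.2, hs.1, norm_nonneg q]
  obtain ⟨δ₁, hδ₁, H₁⟩ := hcomp hg₁ h₁
  obtain ⟨δ₂, hδ₂, H₂⟩ := hcomp hg₂ h₂
  obtain ⟨q, hq, hqδ⟩ := hdense.exists_mem_open Metric.isOpen_ball
    ⟨(0 : F), Metric.mem_ball_self (lt_min hδ₁ hδ₂)⟩
  rw [mem_ball_zero_iff, lt_min_iff] at hqδ
  simp only [Set.mem_compl_iff, Set.mem_iUnion, Set.mem_union, not_exists, not_or] at hq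
  refine ⟨q, fun t ht s hs hs0 => ⟨⟨H₁ q hqδ.1 t ht s hs, ?_⟩, ⟨H₂ q hqδ.2 t ht s hs, ?_⟩⟩⟩
  · simp only [Set.mem_iUnion, not_exists]
    exact fun i hi => (hq i).1 ⟨t, s, hs0, hi⟩
  · simp only [Set.mem_iUnion, not_exists]
    exact fun i hi => (hq i).2 ⟨t, s, hs0, hi⟩

/-- A star-shaped open set minus (closed) countably many subspaces of real codimension at least
three is simply connected. -/
theorem simplyConnectedSpace_starConvex_diff
    (hL : ∀ i, Module.finrank ℝ (L i) + 3 ≤ Module.finrank ℝ F)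
    (hΩ : IsOpen Ω) (hstar : StarConvex ℝ 0 Ω) (h0 : (0 : F) ∈ Ω)
    (hW : IsOpen (Ω \ ⋃ i, (L i : Set F))) :
    SimplyConnectedSpace ↥(Ω \ ⋃ i, (L i : Set F)) := by
  set W : Set F := Ω \ ⋃ i, (L i : Set F) with hWdef
  rw [simply_connected_iff_paths_homotopic']
  constructor
  · rw [← isPathConnected_iff_pathConnectedSpace]
    obtain ⟨q₀, hq₀⟩ := exists_common_cone_vertex hL hΩ hstar contDiff_const contDiff_const
      (g₁ := fun _ => 0) (g₂ := fun _ => 0) (fun _ _ => h0) (fun _ _ => h0)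
    have hq₀W : q₀ ∈ W := by simpa [hWdef] using (hq₀ 0 (by simp) 1 (by simp) one_ne_zero).1
    refine isPathConnected_iff.2 ⟨⟨q₀, hq₀W⟩, fun x hx y hy => ?_⟩
    obtain ⟨q, hq⟩ := exists_common_cone_vertex hL hΩ hstar contDiff_const contDiff_const
      (g₁ := fun _ => x) (g₂ := fun _ => y) (fun _ _ => hx.1) (fun _ _ => hy.1)
    have hseg {z : F} (hz : z ∈ W) (H : ∀ s ∈ I, s ≠ 0 → (1 - s) • z + s • q ∈ W) :
        JoinedIn W z q := by
      refine JoinedIn.of_segment_subset ?_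
      rw [segment_eq_image]
      rintro _ ⟨s, hs, rfl⟩
      rcases eq_or_ne s 0 with rfl | h
      · simpa using hz
      · exact H s hs h
    exact (hseg hx fun s hs h => (hq 0 (by simp) s hs h).1).trans
      (hseg hy fun s hs h => (hq 0 (by simp) s hs h).2).symm
  intro x y γ₁ γ₂
  -- replace a path by a smooth one
  have smooth (γ : Path x y) : ∃ (g : ℝ → F) (γ' : Path x y), ContDiff ℝ 1 g ∧
      (∀ t : I, g t = γ' t) ∧ Path.Homotopic γ γ' := by
    have hc : Continuous fun t : ℝ => (γ.extend t : F) :=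
      continuous_subtype_val.comp γ.continuous_extend
    have hK : IsCompact ((fun t : ℝ => (γ.extend t : F)) '' I) := isCompact_Icc.image hc
    obtain ⟨ε, hε, hsub⟩ := hK.exists_thickening_subset_open hW (by
      rintro _ ⟨t, _, rfl⟩
      exact (γ.extend t).2)
    obtain ⟨g, hg, hg0, hg1, hgε⟩ := exists_contDiff_path_near hc hε
    have hmem : ∀ s ∈ I, ∀ t ∈ I, (1 - s) • (γ.extend t : F) + s • g t ∈ W := by
      intro s hs t ht
      refine hsub (Metric.mem_thickening_iff.2 ⟨_, ⟨t, ht, rfl⟩, ?_⟩)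
      rw [dist_eq_norm, show (1 - s) • (γ.extend t : F) + s • g t - (γ.extend t : F) =
        s • (g t - (γ.extend t : F)) by module, norm_smul, Real.norm_of_nonneg hs.1]
      have := hgε t ht
      rw [dist_eq_norm] at this
      nlinarith [hs.1, hs.2, norm_nonneg (g t - (γ.extend t : F))]
    have hgW (t : I) : g t ∈ W := by simpa using hmem 1 (by simp) t t.2
    refine ⟨g, ⟨⟨fun t => ⟨g t, hgW t⟩, by have := hg.continuous; fun_prop⟩, ?_, ?_⟩, hg,
      fun t => rfl, ?_⟩
    · exact Subtype.ext (by simpa using hg0)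
    · exact Subtype.ext (by simpa using hg1)
    · refine Path.Homotopic.of_continuous_plane
        (fun s t => (1 - s) • (γ.extend t : F) + s • g t) ?_ hmem ?_ ?_ ?_ ?_
      · have := hg.continuous
        have h' : Continuous fun z : ℝ × ℝ => (γ.extend z.2 : F) := hc.comp continuous_snd
        fun_prop
      · intro t; simp
      · intro t; simp
      · intro s _; simp [hg0, ← add_smul]
      · intro s _; simp [hg1, ← add_smul]
  obtain ⟨g₁, γ₁', hg₁, e₁, hom₁⟩ := smooth γ₁
  obtain ⟨g₂, γ₂', hg₂, e₂, hom₂⟩ := smooth γ₂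
  have m₁ : ∀ t ∈ I, g₁ t ∈ W := fun t ht => by rw [e₁ ⟨t, ht⟩]; exact (γ₁' _).2
  have m₂ : ∀ t ∈ I, g₂ t ∈ W := fun t ht => by rw [e₂ ⟨t, ht⟩]; exact (γ₂' _).2
  obtain ⟨q, hq⟩ := exists_common_cone_vertex hL hΩ hstar hg₁ hg₂
    (fun t ht => (m₁ t ht).1) (fun t ht => (m₂ t ht).1)
  -- slide a path to the broken line through the vertex of the cone
  let lam (t : ℝ) : ℝ := min 1 (min (3 * t) (3 - 3 * t))
  let r (t : ℝ) : ℝ := max 0 (min 1 (3 * t - 1))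
  have hlam : ∀ t ∈ I, lam t ∈ I := fun t ht =>
    ⟨le_min zero_le_one (le_min (by linarith [ht.1]) (by linarith [ht.2])), min_le_left _ _⟩
  have hr : ∀ t, r t ∈ I := fun t =>
    ⟨le_max_left _ _, max_le zero_le_one (min_le_left _ _)⟩
  -- At `s = 0` this is `g`. At `s = 1` it runs straight from `x` to `q` while `r` waits at 0, rests
  -- at `q` while `r` moves from 0 to 1 (there `lam = 1`, so `g` has weight zero), and runs straight
  -- to `y`. The final path is thus the same for `g₁` and `g₂`.
  let H (g : ℝ → F) (s t : ℝ) : F :=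
    (1 - s * lam t) • g ((1 - s) * t + s * r t) + (s * lam t) • q
  have hHc {g : ℝ → F} (hg : ContDiff ℝ 1 g) : Continuous fun z : ℝ × ℝ => H g z.1 z.2 := by
    have := hg.continuous
    fun_prop
  have hHW {g : ℝ → F} (mg : ∀ t ∈ I, g t ∈ W)
      (hg : ∀ t ∈ I, ∀ s ∈ I, s ≠ 0 → (1 - s) • g t + s • q ∈ W) :
      ∀ s ∈ I, ∀ t ∈ I, H g s t ∈ W := by
    intro s hs t ht
    have h1 : (1 - s) * t + s * r t ∈ I :=
      convex_Icc (0 : ℝ) 1 ht (hr t) (by linarith [hs.2]) hs.1 (by ring)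
    have h2 : s * lam t ∈ I := ⟨mul_nonneg hs.1 (hlam t ht).1,
      mul_le_one₀ hs.2 (hlam t ht).1 (hlam t ht).2⟩
    rcases eq_or_ne (s * lam t) 0 with h | h
    · simpa [H, h] using mg _ h1
    · exact hg _ h1 _ h2 h
  have r0 : r 0 = 0 := by simp [r]
  have r1 : r 1 = 1 := by norm_num [r]
  have l0 : lam 0 = 0 := by norm_num [lam]
  have l1 : lam 1 = 0 := by norm_num [lam]
  have hend (t : ℝ) (ht : t ∈ I) : H g₁ 1 t = H g₂ 1 t := by
    have hx : g₁ 0 = g₂ 0 := by rw [show (0 : ℝ) = ((0 : I) : ℝ) from rfl, e₁, e₂]; simp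
    have hy : g₁ 1 = g₂ 1 := by rw [show (1 : ℝ) = ((1 : I) : ℝ) from rfl, e₁, e₂]; simp
    simp only [H, sub_self, zero_mul, one_mul, zero_add]
    rcases le_total (3 * t) 1 with h | h
    · have : r t = 0 := max_eq_left ((min_le_right _ _).trans (by linarith))
      rw [this, hx]
    · rcases le_total 2 (3 * t) with h' | h'
      · have : r t = 1 := by
          simp only [r]
          rw [min_eq_left (by linarith), max_eq_right zero_le_one]
        rw [this, hy]
      · have : lam t = 1 := min_eq_left (le_min h (by linarith))
        simp [this]
  have hW₁ := hHW m₁ fun t ht s hs h => (hq t ht s hs h).1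
  have hW₂ := hHW m₂ fun t ht s hs h => (hq t ht s hs h).2
  have gx₁ : g₁ 0 = x := by simpa using e₁ 0
  have gy₁ : g₁ 1 = y := by simpa using e₁ 1
  have gx₂ : g₂ 0 = x := by simpa using e₂ 0
  have gy₂ : g₂ 1 = y := by simpa using e₂ 1
  let γ₃ : Path x y := ⟨⟨fun t => ⟨H g₁ 1 t, hW₁ 1 (by simp) t t.2⟩, by
      refine Continuous.subtype_mk ?_ _
      exact (hHc hg₁).comp (by fun_prop : Continuous fun t : I => ((1 : ℝ), (t : ℝ)))⟩,
    Subtype.ext (by simp [H, r0, l0, gx₁]), Subtype.ext (by simp [H, r1, l1, gy₁])⟩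
  have c₁ : Path.Homotopic γ₁' γ₃ :=
    Path.Homotopic.of_continuous_plane (H g₁) (hHc hg₁) hW₁ (fun t => by simp [H, e₁])
      (fun t => rfl) (fun s _ => by simp [H, r0, l0, gx₁]) (fun s _ => by simp [H, r1, l1, gy₁])
  have c₂ : Path.Homotopic γ₂' γ₃ :=
    Path.Homotopic.of_continuous_plane (H g₂) (hHc hg₂) hW₂ (fun t => by simp [H, e₂])
      (fun t => (hend t t.2).symm) (fun s _ => by simp [H, r0, l0, gx₂])
      (fun s _ => by simp [H, r1, l1, gy₂])
  exact hom₁.trans (c₁.trans (c₂.symm.trans hom₂.symm))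

end Complement

end

noncomputable section

namespace GITQuotient

open MvPolynomial

/-! ### Invariants of a diagonal torus action -/

section TorusInvariants

variable {σ : Type*} (a : σ → ℤ)

/-- The polynomials all of whose monomials have weight zero, where `X i` has weight `a i`. -/
def torusInvariants : Subalgebra ℂ (MvPolynomial σ ℂ) where
  carrier := {h | IsWeightedHomogeneous a h 0}
  mul_mem' hx hy := by simpa using! IsWeightedHomogeneous.mul hx hy
  add_mem' hx hy := IsWeightedHomogeneous.add hx hy
  algebraMap_mem' r := isWeightedHomogeneous_C a r

variable {a}

theorem mem_torusInvariants {h : MvPolynomial σ ℂ} :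
    h ∈ torusInvariants a ↔ IsWeightedHomogeneous a h 0 := Iff.rfl

variable (a) in
/-- The exponents of invariant monomials. -/
def invariantExponents : AddSubmonoid (σ →₀ ℕ) := AddMonoidHom.mker (Finsupp.weight a)

theorem mem_invariantExponents {d : σ →₀ ℕ} :
    d ∈ invariantExponents a ↔ Finsupp.weight a d = 0 := Iff.rfl

/-- The invariant monomial with a given exponent. -/
def invariantMonomial (d : invariantExponents a) : torusInvariants a :=
  ⟨monomial (d : σ →₀ ℕ) 1, isWeightedHomogeneous_monomial a _ _ (mem_invariantExponents.1 d.2)⟩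

@[simp]
theorem coe_invariantMonomial (d : invariantExponents a) :
    (invariantMonomial d : MvPolynomial σ ℂ) = monomial (d : σ →₀ ℕ) 1 := rfl

theorem invariantMonomial_add (d e : invariantExponents a) :
    invariantMonomial (d + e) = invariantMonomial d * invariantMonomial e :=
  Subtype.ext (by simp)

theorem invariantMonomial_zero : invariantMonomial (0 : invariantExponents a) = 1 :=
  Subtype.ext (by simp)

theorem span_range_invariantMonomial :
    Submodule.span ℂ (Set.range (invariantMonomial (a := a))) = ⊤ := by
  rw [eq_top_iff]
  rintro ⟨h, hh⟩ -
  refine IsWeightedHomogeneous.induction_on (w := a) (m := 0)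
    (motive := fun p hp => (⟨p, hp⟩ : torusInvariants a) ∈
      Submodule.span ℂ (Set.range (invariantMonomial (a := a)))) (Submodule.zero_mem _)
    (fun p q hp hq h1 h2 => Submodule.add_mem _ h1 h2) (fun d r hd => ?_) hh
  have : (⟨monomial d r, isWeightedHomogeneous_monomial a d r hd⟩ : torusInvariants a) =
      r • invariantMonomial ⟨d, hd⟩ := Subtype.ext (by simp [smul_monomial])
  rw [this]
  exact Submodule.smul_mem _ _ (Submodule.subset_span ⟨_, rfl⟩)

theorem torusInvariants_linearMap_ext {M : Type*} [AddCommMonoid M] [Module ℂ M]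
    {f g : torusInvariants a →ₗ[ℂ] M}
    (h : ∀ d, f (invariantMonomial d) = g (invariantMonomial d)) : f = g :=
  LinearMap.ext_on_range span_range_invariantMonomial h

/-- Gordan's lemma: the invariant exponents are the kernel of a homomorphism on ℕ^σ, hence closed
under those subtractions that are possible, hence a finitely generated monoid. -/
instance [Finite σ] : Algebra.FiniteType ℂ (torusInvariants a) := by
  have hfg : (invariantExponents a).FG := by
    refine AddSubmonoid.fg_of_subtractive fun d hd e he => ?_
    rw [mem_invariantExponents] at hd he ⊢
    rwa [map_add, hd, zero_add] at he
  rw [AddSubmonoid.fg_iff] at hfg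
  obtain ⟨S, hS, hSfin⟩ := hfg
  have hsub : S ⊆ invariantExponents a := hS ▸ AddSubmonoid.subset_closure
  have hT : (invariantMonomial '' {d : invariantExponents a | (d : σ →₀ ℕ) ∈ S}).Finite := by
    refine Set.Finite.image _ ?_
    exact hSfin.preimage Subtype.val_injective.injOn
  refine ⟨⟨hT.toFinset, ?_⟩⟩
  rw [Set.Finite.coe_toFinset, eq_top_iff]
  have hmem : ∀ (d : σ →₀ ℕ) (hd : d ∈ AddSubmonoid.closure S), invariantMonomial ⟨d, hS ▸ hd⟩ ∈
      Algebra.adjoin ℂ (invariantMonomial '' {d : invariantExponents a | (d : σ →₀ ℕ) ∈ S}) := by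
    intro d hd
    induction hd using AddSubmonoid.closure_induction with
    | mem x hx => exact Algebra.subset_adjoin ⟨⟨x, hsub hx⟩, hx, rfl⟩
    | zero => exact invariantMonomial_zero (a := a) ▸ Subalgebra.one_mem _
    | add x y hx hy h1 h2 =>
      have := invariantMonomial_add (a := a) ⟨x, hS ▸ hx⟩ ⟨y, hS ▸ hy⟩
      exact this ▸ Subalgebra.mul_mem _ h1 h2
  intro h _
  have : h ∈ Submodule.span ℂ (Set.range (invariantMonomial (a := a))) := by
    rw [span_range_invariantMonomial]; trivial
  rw [← Subalgebra.mem_toSubmodule]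
  refine Submodule.span_le.2 ?_ this
  rintro _ ⟨d, rfl⟩
  exact hmem d (hS.symm ▸ d.2)

instance [Finite σ] : IsNoetherianRing (torusInvariants a) :=
  Algebra.FiniteType.isNoetherianRing ℂ _

/-- The projection to the weight zero part is linear over the invariants. -/
theorem weightedHomogeneousComponent_zero_mul {h : MvPolynomial σ ℂ} (hh : h ∈ torusInvariants a)
    (f : MvPolynomial σ ℂ) :
    weightedHomogeneousComponent a 0 (h * f) = h * weightedHomogeneousComponent a 0 f := by
  induction f using MvPolynomial.induction_on' with
  | monomial d r =>
    have hd := isWeightedHomogeneous_monomial (R := ℂ) a d r rfl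
    have hm : IsWeightedHomogeneous a (h * monomial d r) (Finsupp.weight a d) := by
      simpa using IsWeightedHomogeneous.mul (mem_torusInvariants.1 hh) hd
    by_cases h0 : Finsupp.weight a d = 0
    · rw [h0] at hd hm
      rw [hd.weightedHomogeneousComponent_same, hm.weightedHomogeneousComponent_same]
    · rw [hd.weightedHomogeneousComponent_ne 0 (Ne.symm h0),
        hm.weightedHomogeneousComponent_ne 0 (Ne.symm h0), mul_zero]
  | add p q hp hq => simp only [mul_add, map_add, hp, hq]

variable (a) in
/-- The quotient map in coordinates. -/
def evalPoint (v : σ → ℂ) : ComplexPoints (torusInvariants a) :=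
  (aeval v).comp (torusInvariants a).val

theorem evalPoint_apply (v : σ → ℂ) (h : torusInvariants a) :
    (show torusInvariants a →ₐ[ℂ] ℂ from evalPoint a v) h = aeval v (h : MvPolynomial σ ℂ) := rfl

/-- The projection to weight zero is a Reynolds operator. It shows that the ideal of a point
generates a proper ideal of the polynomial ring, and the Nullstellensatz then supplies a point
above. -/
theorem evalPoint_surjective [Finite σ] : Function.Surjective (evalPoint a) := by
  intro x
  let x' : torusInvariants a →ₐ[ℂ] ℂ := x
  let ker := RingHom.ker x'
  -- The largest ideal whose weight zero projection lies in `ker`.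
  let J : Ideal (MvPolynomial σ ℂ) :=
    { carrier := {f | ∀ r, ∃ k ∈ ker, weightedHomogeneousComponent a 0 (r * f) = k}
      zero_mem' := fun r => ⟨0, ker.zero_mem, by simp⟩
      add_mem' := by
        intro f g hf hg r
        obtain ⟨k, hk, hk'⟩ := hf r
        obtain ⟨l, hl, hl'⟩ := hg r
        exact ⟨k + l, ker.add_mem hk hl, by rw [mul_add, map_add, hk', hl']; rfl⟩
      smul_mem' := by
        intro c f hf r
        obtain ⟨k, hk, hk'⟩ := hf (r * c)
        exact ⟨k, hk, by rw [smul_eq_mul, ← mul_assoc, hk']⟩ }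
  have hJ : J ≠ ⊤ := by
    intro h
    have h1 : (1 : MvPolynomial σ ℂ) ∈ J := h ▸ Submodule.mem_top
    obtain ⟨k, hk, hk'⟩ := h1 1
    rw [mul_one, (isWeightedHomogeneous_one ℂ a).weightedHomogeneousComponent_same] at hk'
    have : k = 1 := Subtype.ext hk'.symm
    rw [this, RingHom.mem_ker, map_one] at hk
    exact one_ne_zero hk
  have hker : ∀ k ∈ ker, (k : MvPolynomial σ ℂ) ∈ J := by
    intro k hk r
    refine ⟨k * ⟨weightedHomogeneousComponent a 0 r,
      weightedHomogeneousComponent_isWeightedHomogeneous 0 r⟩, ker.mul_mem_right _ hk, ?_⟩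
    rw [mul_comm, weightedHomogeneousComponent_zero_mul k.2]
    rfl
  obtain ⟨M, hM, hJM⟩ := J.exists_le_maximal hJ
  obtain ⟨v, rfl⟩ := eq_vanishingIdeal_singleton_of_isMaximal ℂ hM
  refine ⟨v, ?_⟩
  refine AlgHom.ext fun h => ?_
  have h1 : h - algebraMap ℂ _ (x' h) ∈ ker := by
    rw [RingHom.mem_ker, map_sub, AlgHom.commutes]
    simp
  have h2 := hJM (hker _ h1)
  rw [mem_vanishingIdeal_singleton_iff] at h2
  rw [AddSubgroupClass.coe_sub, map_sub, sub_eq_zero] at h2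
  exact h2.trans (AlgHom.commutes (aeval v) _)

/-- The i-th term of a polynomial relation in `X α` is homogeneous of weight i · a α. These weights
are distinct, so every term vanishes separately. -/
theorem transcendental_X {α : σ} (hα : a α ≠ 0) :
    Transcendental (torusInvariants a) (X α : MvPolynomial σ ℂ) := by
  rw [transcendental_iff]
  intro p hp
  ext n : 1
  apply Subtype.ext
  have := congrArg (weightedHomogeneousComponent a (n • a α)) hp
  rw [Polynomial.aeval_eq_sum_range, map_sum, map_zero] at this
  have hterm (i : ℕ) : IsWeightedHomogeneous a
      (p.coeff i • (X α : MvPolynomial σ ℂ) ^ i) (i • a α) := by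
    rw [Algebra.smul_def]
    simpa using IsWeightedHomogeneous.mul (mem_torusInvariants.1 (p.coeff i).2)
      ((isWeightedHomogeneous_X ℂ a α).pow i)
  have hne (i : ℕ) (hi : i ≠ n) : weightedHomogeneousComponent a (n • a α)
      (p.coeff i • (X α : MvPolynomial σ ℂ) ^ i) = 0 := by
    refine (hterm i).weightedHomogeneousComponent_ne _ fun h => hi ?_
    simp only [nsmul_eq_mul] at h
    exact_mod_cast (mul_right_cancel₀ hα h).symm
  by_cases hn : n ∈ Finset.range (p.natDegree + 1)
  · rw [Finset.sum_eq_single_of_mem n hn (fun i _ hi => hne i hi),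
      (hterm n).weightedHomogeneousComponent_same, Algebra.smul_def] at this
    simpa using (mul_eq_zero.1 this).resolve_right (pow_ne_zero _ (X_ne_zero α))
  · rw [Finset.mem_range, not_lt] at hn
    rw [Polynomial.coeff_eq_zero_of_natDegree_lt (by omega)]
    rfl

theorem ringKrullDim_le_of_isIntegral {R S : Type*} [CommRing R] [CommRing S] [Algebra R S]
    [Algebra.IsIntegral R S] : ringKrullDim S ≤ ringKrullDim R :=
  Order.krullDim_le_of_strictMono (PrimeSpectrum.comap (algebraMap R S))
    fun _ _ h => Ideal.IsIntegral.comap_lt_comap h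

/-- By Noether normalization the invariants are integral over a polynomial ring in `s` variables,
and `X α` contributes one more to the transcendence degree, so `s + 1` is at most |σ|. -/
theorem ringKrullDim_torusInvariants_le [Fintype σ] {α : σ} (hα : a α ≠ 0) :
    ringKrullDim (torusInvariants a) ≤ (Fintype.card σ - 1 : ℕ) := by
  obtain ⟨s, g, hg, hint⟩ := exists_integral_inj_algHom_of_fg ℂ (torusInvariants a)
  have hdim : ringKrullDim (torusInvariants a) ≤ s := by
    let _ : Algebra (MvPolynomial (Fin s) ℂ) (torusInvariants a) := g.toRingHom.toAlgebra
    have : Algebra.IsIntegral (MvPolynomial (Fin s) ℂ) (torusInvariants a) := ⟨hint⟩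
    refine (ringKrullDim_le_of_isIntegral (R := MvPolynomial (Fin s) ℂ)).trans ?_
    rw [MvPolynomial.ringKrullDim_of_isNoetherianRing]
    simp
  have halg : AlgebraicIndependent ℂ fun i : Fin s => g (X i) := by
    rw [AlgebraicIndependent]
    convert hg
    ext
    simp
  have h1 : (s : Cardinal) ≤ Algebra.trdeg ℂ (torusInvariants a) := by
    simpa using halg.lift_cardinalMk_le_trdeg
  have : Algebra.Transcendental (torusInvariants a) (MvPolynomial σ ℂ) :=
    ⟨X α, transcendental_X hα⟩
  have h2 : (1 : Cardinal) ≤ Algebra.trdeg (torusInvariants a) (MvPolynomial σ ℂ) :=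
    Cardinal.one_le_iff_pos.2 (trdeg_pos _ _)
  have h3 := trdeg_add_le (R := ℂ) (S := torusInvariants a) (A := MvPolynomial σ ℂ)
  rw [MvPolynomial.trdeg_of_isDomain] at h3
  have h4 : ((s + 1 : ℕ) : Cardinal) ≤ (Fintype.card σ : Cardinal) := by
    push_cast
    refine (add_le_add h1 h2).trans (h3.trans ?_)
    simp
  have h5 : s + 1 ≤ Fintype.card σ := by exact_mod_cast h4
  exact hdim.trans (by exact_mod_cast (by omega : s ≤ Fintype.card σ - 1))

end TorusInvariants

end GITQuotient

end

noncomputable section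

namespace GITQuotient

/-! ### Point derivations and regularity -/

section PointDerivations

variable {A : Type*} [CommRing A] [Algebra ℂ A]

/-- At a regular point of a variety of dimension at most `d` there are at most `d` linearly
independent point derivations. -/
theorem card_le_of_notMem_singularLocus {x : A →ₐ[ℂ] ℂ}
    (hreg : (show ComplexPoints A from x) ∉ singularLocus A) {d : ℕ} (hd : ringKrullDim A ≤ d)
    {ι : Type*} [Fintype ι] (D : ι → A →ₗ[ℂ] ℂ)
    (hD : ∀ i f g, D i (f * g) = x f * D i g + D i f * x g) (hli : LinearIndependent ℂ D) :
    Fintype.card ι ≤ d := by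
  classical
  let p : Ideal A := (show ComplexPoints A from x).toPrimeSpectrum.asIdeal
  have hp : p = RingHom.ker x := rfl
  have hreg' : IsRegularLocalRing (Localization.AtPrime p) := not_not.1 hreg
  set m := IsLocalRing.maximalIdeal (Localization.AtPrime p) with hm
  have hr : m.spanFinrank ≤ d := by
    have h1 := hreg'.spanFinrank_maximalIdeal
    rw [IsLocalization.AtPrime.ringKrullDim_eq_height p] at h1
    have h2 : (p.height : WithBot ℕ∞) ≤ d :=
      (Ideal.height_le_ringKrullDim_of_isPrime).trans hd
    rw [← h1] at h2
    exact_mod_cast h2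
  -- Minimal generators of the maximal ideal, with denominators cleared so that functionals on `A`
  -- can be evaluated on them.
  obtain ⟨s, hscard, hspan⟩ : ∃ s : Finset A, s.card ≤ d ∧
      Ideal.map (algebraMap A (Localization.AtPrime p)) (Ideal.span s) = m ∧ ∀ t ∈ s, t ∈ p := by
    have hfg : m.FG := IsNoetherian.noetherian m
    obtain ⟨S, hScard, hSspan⟩ :=
      Submodule.FG.exists_span_finset_card_eq_spanFinrank hfg
    have hnum (z : Localization.AtPrime p) : ∃ n : A, ∃ u : p.primeCompl,
        z * algebraMap A _ (u : A) = algebraMap A _ n := by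
      obtain ⟨⟨n, u⟩, h⟩ := IsLocalization.surj p.primeCompl z
      exact ⟨n, u, h⟩
    choose n u hnu using hnum
    have hunit (z : Localization.AtPrime p) :
        IsUnit (algebraMap A (Localization.AtPrime p) (u z : A)) :=
      IsLocalization.map_units _ (u z)
    have hmap : Ideal.map (algebraMap A (Localization.AtPrime p))
        (Ideal.span (S.image n : Finset A)) = m := by
      rw [Ideal.map_span]
      apply le_antisymm
      · rw [Ideal.span_le]
        rintro _ ⟨_, hy, rfl⟩
        obtain ⟨z, hz, rfl⟩ := Finset.mem_image.1 (Finset.mem_coe.1 hy)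
        rw [← hnu z, SetLike.mem_coe]
        exact m.mul_mem_right _ (hSspan ▸ Submodule.subset_span hz)
      · rw [← hSspan]
        refine Submodule.span_le.2 fun z hz => ?_
        rw [SetLike.mem_coe, ← Ideal.mul_unit_mem_iff_mem _ (hunit z), hnu z]
        exact Ideal.subset_span ⟨n z, Finset.mem_coe.2 (Finset.mem_image_of_mem n hz), rfl⟩
    refine ⟨S.image n, Finset.card_image_le.trans (hScard.le.trans hr), hmap, fun t ht => ?_⟩
    rw [← IsLocalization.AtPrime.to_map_mem_maximal_iff (Localization.AtPrime p) p, ← hm, ← hmap]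
    exact Ideal.mem_map_of_mem _ (Ideal.subset_span (Finset.mem_coe.2 ht))
  obtain ⟨hspan, hsp⟩ := hspan
  -- A point derivation is determined by its values on `s`: if they vanish, it vanishes on the ideal
  -- of `s`, then on `p`, whose elements enter that ideal after multiplication by something outside
  -- `p`, and then on all of A = ℂ + p.
  let Φ : (ι → ℂ) →ₗ[ℂ] (s → ℂ) :=
    { toFun := fun c t => ∑ i, c i * D i t
      map_add' := fun c c' => by ext t; simp [add_mul, Finset.sum_add_distrib]
      map_smul' := fun r c => by ext t; simp [Finset.mul_sum, mul_assoc] }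
  have hΦ : Function.Injective Φ := by
    rw [← LinearMap.ker_eq_bot, LinearMap.ker_eq_bot']
    intro c hc
    let E : A →ₗ[ℂ] ℂ := ∑ i, c i • D i
    have hE (f g : A) : E (f * g) = x f * E g + E f * x g := by
      simp only [E, LinearMap.sum_apply, LinearMap.smul_apply, smul_eq_mul, hD, Finset.mul_sum,
        Finset.sum_mul, ← Finset.sum_add_distrib]
      exact Finset.sum_congr rfl fun i _ => by ring
    have hE1 : E 1 = 0 := by simpa using hE 1 1
    have hEs : ∀ t ∈ Ideal.span (s : Set A), E t = 0 ∧ x t = 0 := by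
      intro t ht
      induction ht using Submodule.span_induction with
      | mem t ht =>
        refine ⟨?_, hsp t ht⟩
        simpa [E, Φ] using congrFun hc ⟨t, ht⟩
      | zero => simp
      | add f g _ _ hf hg => simp [hf, hg]
      | smul r f _ hf => simp [hE, hf]
    have hEp (h : A) (hh : x h = 0) : E h = 0 := by
      have h1 : algebraMap A (Localization.AtPrime p) h ∈
          Ideal.map (algebraMap A (Localization.AtPrime p)) (Ideal.span s) := by
        rw [hspan, hm, ← IsLocalization.AtPrime.map_eq_maximalIdeal p]
        exact Ideal.mem_map_of_mem _ hh
      rw [IsLocalization.mem_map_algebraMap_iff p.primeCompl] at h1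
      obtain ⟨⟨⟨t, ht⟩, u⟩, h2⟩ := h1
      rw [← map_mul, IsLocalization.eq_iff_exists p.primeCompl] at h2
      obtain ⟨c, h3⟩ := h2
      have h4 : E (c * u * h) = 0 := by
        rw [mul_assoc, mul_comm (u : A) h, h3]
        exact (hEs _ (Ideal.mul_mem_left _ _ ht)).1
      rw [hE, hh, mul_zero, add_zero, map_mul] at h4
      exact (mul_eq_zero.1 h4).resolve_left (mul_ne_zero c.2 u.2)
    have hE0 : E = 0 := by
      ext f
      have h1 := hEp (f - algebraMap ℂ A (x f)) (by simp)
      rw [map_sub, Algebra.algebraMap_eq_smul_one, map_smul, hE1, smul_zero, sub_zero] at h1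
      exact h1
    ext i
    exact (Fintype.linearIndependent_iff.1 hli) c hE0 i
  have := LinearMap.finrank_le_finrank_of_injective hΦ
  simp only [Module.finrank_fintype_fun_eq_card, Fintype.card_coe] at this
  exact this.trans hscard

end PointDerivations

end GITQuotient

end

noncomputable section

namespace GITQuotient

open MvPolynomial

/-! ### Singular points of the quotient by a diagonal torus action -/

section Singular

variable {σ : Type*} {a : σ → ℤ}

theorem dvd_weight {k : ℤ} {I : Set σ} (hI : ∀ i ∈ I, k ∣ a i) {u : σ →₀ ℕ}
    (hu : ↑u.support ⊆ I) : k ∣ Finsupp.weight a u := by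
  rw [Finsupp.weight_apply]
  exact Finset.dvd_sum fun i hi => by
    change k ∣ u i • a i
    rw [nsmul_eq_mul]
    exact Dvd.dvd.mul_left (hI i (hu hi)) _

variable (a) in
/-- `k` is the order of the generic stabilizer of the points with support `I`, with `k = 0` if
all these points are fixed; moreover, the weights `k` and `-k` are attained by monomials. -/
def IsStabilizerOrder (I : Set σ) (k : ℕ) : Prop :=
  (∀ i ∈ I, (k : ℤ) ∣ a i) ∧ ∃ u w : σ →₀ ℕ, ↑u.support ⊆ I ∧ ↑w.support ⊆ I ∧
    Finsupp.weight a u = k ∧ Finsupp.weight a w = -k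

theorem isStabilizerOrder_zero {I : Set σ} (hI : ∀ i ∈ I, a i = 0) : IsStabilizerOrder a I 0 :=
  ⟨fun i hi => by simp [hI i hi], 0, 0, by simp⟩

/-- The weights of monomials supported in `I` form a submonoid of ℤ. Since it contains elements of
both signs it is a subgroup, and `k` is its generator. -/
theorem exists_isStabilizerOrder {I : Set σ} (hpos : ∃ i ∈ I, 0 < a i) (hneg : ∃ i ∈ I, a i < 0) :
    ∃ k, k ≠ 0 ∧ IsStabilizerOrder a I k := by
  let M : AddSubmonoid ℤ :=
    { carrier := {m | ∃ u : σ →₀ ℕ, ↑u.support ⊆ I ∧ Finsupp.weight a u = m}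
      zero_mem' := ⟨0, by simp⟩
      add_mem' := by
        classical
        rintro _ _ ⟨u, hu, rfl⟩ ⟨w, hw, rfl⟩
        refine ⟨u + w, fun i hi => ?_, map_add _ _ _⟩
        rcases Finset.mem_union.1 (Finsupp.support_add hi) with h | h
        exacts [hu h, hw h] }
  have hM (i : σ) (hi : i ∈ I) : a i ∈ M := by
    refine ⟨Finsupp.single i 1, fun j hj => ?_, by simp [Finsupp.weight_single]⟩
    have := Finsupp.support_single_subset hj
    rw [Finset.mem_singleton] at this
    exact this ▸ hi
  obtain ⟨i, hi, hi0⟩ := hpos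
  obtain ⟨j, hj, hj0⟩ := hneg
  -- For m ≥ 0, -m = (-a j - 1) · m + m · a j with nonnegative multipliers; for m ≤ 0, -m = (a i -
  -- 1) · m + (-m) · a i.
  have hnegM (m : ℤ) (hm : m ∈ M) : -m ∈ M := by
    rcases le_total 0 m with h | h
    · have h1 := M.add_mem (M.nsmul_mem hm (-a j - 1).toNat) (M.nsmul_mem (hM j hj) m.toNat)
      rw [nsmul_eq_mul, nsmul_eq_mul, Int.toNat_of_nonneg (by omega), Int.toNat_of_nonneg h] at h1
      convert h1 using 1
      ring
    · have h1 := M.add_mem (M.nsmul_mem hm (a i - 1).toNat) (M.nsmul_mem (hM i hi) (-m).toNat)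
      rw [nsmul_eq_mul, nsmul_eq_mul, Int.toNat_of_nonneg (by omega),
        Int.toNat_of_nonneg (by omega)] at h1
      convert h1 using 1
      ring
  let H : AddSubgroup ℤ := { M with neg_mem' := fun {m} hm => hnegM m hm }
  obtain ⟨g, hg⟩ := Int.subgroup_cyclic H
  rw [← AddSubgroup.zmultiples_eq_closure] at hg
  have hdvd (l : σ) (hl : l ∈ I) : g ∣ a l := by
    have : a l ∈ H := hM l hl
    rwa [hg, Int.mem_zmultiples_iff] at this
  have hgH : g ∈ M := show g ∈ H from hg ▸ AddSubgroup.mem_zmultiples g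
  have hk : ((g.natAbs : ℤ) ∈ M) ∧ (-(g.natAbs : ℤ) ∈ M) := by
    rcases Int.natAbs_eq g with h | h
    · rw [← h]; exact ⟨hgH, hnegM g hgH⟩
    · rw [← h, show (g.natAbs : ℤ) = -g by omega]; exact ⟨hnegM g hgH, hgH⟩
  obtain ⟨⟨u, hu, hu'⟩, ⟨w, hw, hw'⟩⟩ := hk
  refine ⟨g.natAbs, ?_, fun l hl => Int.natAbs_dvd.2 (hdvd l hl), u, w, hu, hw, hu', hw'⟩
  intro h0
  rw [Int.natAbs_eq_zero] at h0
  have := hdvd i hi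
  rw [h0, zero_dvd_iff] at this
  omega

/-- A weight k z is cancelled by z copies of `w`, or by -z copies of `u` if z is negative. In this
way an exponent transverse to the orbit is realized by an invariant monomial. -/
theorem IsStabilizerOrder.exists_extension {I : Set σ} {k : ℕ} (h : IsStabilizerOrder a I k)
    {e : σ →₀ ℕ} (he : (k : ℤ) ∣ Finsupp.weight a e) :
    ∃ u : σ →₀ ℕ, ↑u.support ⊆ I ∧ e + u ∈ invariantExponents a := by
  classical
  obtain ⟨-, u, w, hu, hw, hu', hw'⟩ := h
  obtain ⟨z, hz⟩ := he
  refine ⟨z.toNat • w + (-z).toNat • u, fun i hi => ?_, ?_⟩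
  · rcases Finset.mem_union.1 (Finsupp.support_add hi) with h | h
    · exact hw (Finsupp.support_smul h)
    · exact hu (Finsupp.support_smul h)
  · rw [mem_invariantExponents, map_add, map_add, map_nsmul, map_nsmul, hu', hw', hz, nsmul_eq_mul,
      nsmul_eq_mul]
    have h1 : (z.toNat : ℤ) - ((-z).toNat : ℤ) = z := by omega
    linear_combination -(k : ℤ) * h1

/-- An exponent that is not a sum of two nonzero exponents with weights divisible by `k`. -/
def IsIrreducibleMod (a : σ → ℤ) (k : ℕ) (e : σ →₀ ℕ) : Prop :=
  e ≠ 0 ∧ (k : ℤ) ∣ Finsupp.weight a e ∧ ∀ e' e'' : σ →₀ ℕ, (k : ℤ) ∣ Finsupp.weight a e' →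
    (k : ℤ) ∣ Finsupp.weight a e'' → e' + e'' = e → e' = 0 ∨ e'' = 0

/-- A proper splitting separates the two factors, whose weights 1 and -1 are not divisible by `k`.
For `k = 0` divisibility means weight zero. -/
theorem isIrreducibleMod_pair {k : ℕ} (hk : k ≠ 1) {α β : σ} (hα : a α = 1) (hβ : a β = -1) :
    IsIrreducibleMod a k (Finsupp.single α 1 + Finsupp.single β 1) := by
  classical
  have hαβ : α ≠ β := by rintro rfl; omega
  refine ⟨fun h => by simpa using DFunLike.congr_fun h α, by simp [Finsupp.weight_single, hα, hβ],
    fun e' e'' h' _ h => ?_⟩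
  have hi (i : σ) : e' i + e'' i = (if α = i then 1 else 0) + (if β = i then 1 else 0) := by
    simpa [Finsupp.single_apply] using DFunLike.congr_fun h i
  have h1 : e' α + e'' α = 1 := by simpa [hαβ.symm] using hi α
  have h2 : e' β + e'' β = 1 := by simpa [hαβ] using hi β
  have h3 (i : σ) (hi1 : i ≠ α) (hi2 : i ≠ β) : e' i = 0 ∧ e'' i = 0 := by
    simpa [hi1.symm, hi2.symm] using hi i
  have hwt : Finsupp.weight a e' = e' α - e' β := by
    have : e' = Finsupp.single α (e' α) + Finsupp.single β (e' β) := by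
      ext i
      by_cases hiα : i = α
      · subst hiα; simp [hαβ]
      · by_cases hiβ : i = β
        · subst hiβ; simp [hαβ.symm]
        · simp [(h3 i hiα hiβ).1, Ne.symm hiα, Ne.symm hiβ]
    conv_lhs => rw [this]
    simp [Finsupp.weight_single, hα, hβ]
    ring
  have hunit : ¬ (k : ℤ) ∣ 1 := fun h => hk (by
    have := Int.eq_one_of_dvd_one (by positivity) h
    exact_mod_cast this)
  have hunit' : ¬ (k : ℤ) ∣ -1 := by rwa [dvd_neg]
  rw [hwt] at h'
  have hα1 : e' α = 0 ∨ e' α = 1 := by omega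
  have hβ1 : e' β = 0 ∨ e' β = 1 := by omega
  rcases hα1 with hα1 | hα1 <;> rcases hβ1 with hβ1 | hβ1
  · left
    ext i
    by_cases hiα : i = α
    · subst hiα; simpa using hα1
    · by_cases hiβ : i = β
      · subst hiβ; simpa using hβ1
      · simpa using (h3 i hiα hiβ).1
  · exact absurd (by simpa [hα1, hβ1] using h') hunit
  · exact absurd (by simpa [hα1, hβ1] using h') hunit
  · right
    ext i
    by_cases hiα : i = α
    · subst hiα; simp; omega
    · by_cases hiβ : i = β
      · subst hiβ; simp; omega
      · simpa using (h3 i hiα hiβ).2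

/-- A part of this exponent has weight equal to its degree, and no degree strictly between 0 and `k`
is divisible by `k`. -/
theorem isIrreducibleMod_power {k : ℕ} (hk : k ≠ 0) {α : σ} (hα : a α = 1) :
    IsIrreducibleMod a k (Finsupp.single α k) := by
  classical
  refine ⟨by simpa using hk, by simp [Finsupp.weight_single, hα], fun e' e'' h' _ h => ?_⟩
  have hi (i : σ) : e' i + e'' i = if α = i then k else 0 := by
    simpa [Finsupp.single_apply] using DFunLike.congr_fun h i
  have h1 : e' α + e'' α = k := by simpa using hi α
  have h3 (i : σ) (hi1 : i ≠ α) : e' i = 0 ∧ e'' i = 0 := by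
    simpa [hi1.symm] using hi i
  have he' : e' = Finsupp.single α (e' α) := by
    ext i
    by_cases hiα : i = α
    · subst hiα; simp
    · simp [(h3 i hiα).1, Ne.symm hiα]
  rw [he'] at h'
  simp only [Finsupp.weight_single, hα, nsmul_eq_mul, mul_one] at h'
  have hdvd : k ∣ e' α := by exact_mod_cast h'
  rcases Nat.eq_zero_or_pos (e' α) with h0 | h0
  · left; rw [he', h0]; simp
  · right
    have := Nat.le_of_dvd h0 hdvd
    ext i
    by_cases hiα : i = α
    · subst hiα; simp; omega
    · simpa using (h3 i hiα).2

/-- Among the exponents of weight divisible by `k` that contain `j` once and otherwise only `α` and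
`β`, one of minimal degree is chosen. In a splitting, the part that contains `j` is again a
candidate, so the other part is zero. -/
theorem exists_isIrreducibleMod (k : ℕ) {α β j : σ} (hα : a α = 1) (hβ : a β = -1)
    (hjα : j ≠ α) (hjβ : j ≠ β) :
    ∃ e : σ →₀ ℕ, e j = 1 ∧ (∀ i, e i ≠ 0 → i = j ∨ i = α ∨ i = β) ∧ IsIrreducibleMod a k e := by
  classical
  let S : Set (σ →₀ ℕ) := {e | e j = 1 ∧ (∀ i, e i ≠ 0 → i = j ∨ i = α ∨ i = β) ∧
    (k : ℤ) ∣ Finsupp.weight a e}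
  have hS : S.Nonempty := by
    refine ⟨Finsupp.single j 1 + Finsupp.single β (a j).toNat + Finsupp.single α (-a j).toNat,
      by simp [hjα.symm, hjβ.symm], fun i hi => ?_, ?_⟩
    · by_contra! h
      exact hi (by simp [h.1.symm, h.2.1.symm, h.2.2.symm])
    · simp only [map_add, Finsupp.weight_single, hα, hβ, nsmul_eq_mul]
      have h0 : ((1 : ℕ) : ℤ) * a j + ((a j).toNat : ℤ) * -1 + ((-a j).toNat : ℤ) * 1 = 0 := by
        push_cast
        omega
      rw [h0]
      exact dvd_zero _
  obtain ⟨e, ⟨hej, hesupp, hek⟩, hmin⟩ :=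
    (measure (Finsupp.degree (R := ℕ) (σ := σ))).wf.has_min S hS
  have hdeg {e' e'' : σ →₀ ℕ} (h : e' + e'' = e) (h' : (k : ℤ) ∣ Finsupp.weight a e')
      (h1 : e' j = 1) : e'' = 0 := by
    have hm : e' ∈ S := by
      refine ⟨h1, fun i hi => hesupp i ?_, h'⟩
      rw [← h, Finsupp.add_apply]
      omega
    have := hmin e' hm
    have hd : Finsupp.degree e' + Finsupp.degree e'' = Finsupp.degree e := by rw [← h, map_add]
    change ¬ (Finsupp.degree e' < Finsupp.degree e) at this
    exact (Finsupp.degree_eq_zero_iff _).1 (by omega)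
  refine ⟨e, hej, hesupp, fun h => by simp [h] at hej, hek, fun e' e'' h' h'' h => ?_⟩
  have h1 : e' j + e'' j = 1 := by rw [← hej, ← h]; rfl
  have : e' j = 1 ∨ e'' j = 1 := by omega
  rcases this with h2 | h2
  · exact Or.inr (hdeg h h' h2)
  · exact Or.inl (hdeg (by rw [add_comm, h]) h'' h2)

end Singular

end GITQuotient

end

noncomputable section

namespace GITQuotient

open MvPolynomial

/-! ### Point derivations on the ring of invariants, defined by monomials -/

section Derivations

variable {σ : Type*} {a : σ → ℤ}

/-- A linear functional on the invariants given by its values on monomials. -/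
def monomialFunctional (a : σ → ℤ) (c : (σ →₀ ℕ) → ℂ) : torusInvariants a →ₗ[ℂ] ℂ :=
  (basisMonomials σ ℂ).constr ℂ c ∘ₗ (torusInvariants a).val.toLinearMap

@[simp]
theorem monomialFunctional_invariantMonomial (c : (σ →₀ ℕ) → ℂ) (d : invariantExponents a) :
    monomialFunctional a c (invariantMonomial d) = c d := by
  have : (monomial (d : σ →₀ ℕ) 1 : MvPolynomial σ ℂ) = basisMonomials σ ℂ d := by simp
  simp only [monomialFunctional, LinearMap.comp_apply, AlgHom.toLinearMap_apply,
    Subalgebra.coe_val, coe_invariantMonomial]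
  rw [this, Module.Basis.constr_basis]

theorem isPointDerivation_of_monomials {x : torusInvariants a →ₐ[ℂ] ℂ}
    {D : torusInvariants a →ₗ[ℂ] ℂ}
    (h : ∀ d e, D (invariantMonomial d * invariantMonomial e) =
      x (invariantMonomial d) * D (invariantMonomial e) +
        D (invariantMonomial d) * x (invariantMonomial e)) (f g : torusInvariants a) :
    D (f * g) = x f * D g + D f * x g := by
  have hf : f ∈ Submodule.span ℂ (Set.range (invariantMonomial (a := a))) := by
    rw [span_range_invariantMonomial]; trivial
  have hg : g ∈ Submodule.span ℂ (Set.range (invariantMonomial (a := a))) := by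
    rw [span_range_invariantMonomial]; trivial
  induction hf using Submodule.span_induction with
  | mem f hf =>
    obtain ⟨d, rfl⟩ := hf
    induction hg using Submodule.span_induction with
    | mem g hg => obtain ⟨e, rfl⟩ := hg; exact h d e
    | zero => simp
    | add g g' _ _ h1 h2 => simp only [mul_add, map_add, h1, h2]; ring
    | smul r g _ h1 => simp only [mul_smul_comm, map_smul, h1, smul_eq_mul]; ring
  | zero => simp
  | add f f' _ _ h1 h2 => simp only [add_mul, map_add, h1, h2]; ring
  | smul r f _ h1 => simp only [smul_mul_assoc, map_smul, h1, smul_eq_mul]; ring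

/-- The part of an exponent at the vanishing coordinates of `v`. -/
def vanishingPart (v : σ → ℂ) (b : σ →₀ ℕ) : σ →₀ ℕ :=
  open Classical in b.filter fun i => v i = 0

theorem vanishingPart_add (v : σ → ℂ) (b c : σ →₀ ℕ) :
    vanishingPart v (b + c) = vanishingPart v b + vanishingPart v c := by
  classical exact Finsupp.filter_add

theorem vanishingPart_eq_zero_iff {v : σ → ℂ} {b : σ →₀ ℕ} :
    vanishingPart v b = 0 ↔ ↑b.support ⊆ {i | v i ≠ 0} := by
  classical
  rw [vanishingPart, Finsupp.filter_eq_zero_iff]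
  constructor
  · intro h i hi hv
    exact Finsupp.mem_support_iff.1 hi (h i hv)
  · intro h i hv
    by_contra hb
    exact h (Finsupp.mem_support_iff.2 hb) hv

theorem vanishingPart_eq_self {v : σ → ℂ} {b : σ →₀ ℕ} (h : ∀ i, b i ≠ 0 → v i = 0) :
    vanishingPart v b = b := by
  classical exact Finsupp.filter_eq_self_iff _ _ |>.2 h

/-- The vanishing and the nonvanishing part of an invariant exponent have opposite weights, and `k`
divides the latter. -/
theorem dvd_weight_vanishingPart {v : σ → ℂ} {k : ℤ} (hk : ∀ i, v i ≠ 0 → k ∣ a i) {b : σ →₀ ℕ}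
    (hb : b ∈ invariantExponents a) : k ∣ Finsupp.weight a (vanishingPart v b) := by
  classical
  have h := Finsupp.filter_add_filter_not b (fun i => v i = 0)
  have h1 : k ∣ Finsupp.weight a (b.filter fun i => ¬ v i = 0) :=
    dvd_weight (I := {i | v i ≠ 0}) hk (by
      intro i hi
      rw [Finset.mem_coe, Finsupp.support_filter, Finset.mem_filter] at hi
      exact hi.2)
  rw [mem_invariantExponents, ← h, map_add] at hb
  exact (dvd_add_left h1).1 (hb ▸ dvd_zero k)

variable [Fintype σ]

/-- The value at `v` of the monomial with exponent `b`, ignoring the vanishing coordinates. -/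
def nonvanishingValue (v : σ → ℂ) (b : σ →₀ ℕ) : ℂ :=
  open Classical in ∏ i, (if v i = 0 then 1 else v i) ^ b i

theorem nonvanishingValue_add (v : σ → ℂ) (b c : σ →₀ ℕ) :
    nonvanishingValue v (b + c) = nonvanishingValue v b * nonvanishingValue v c := by
  simp only [nonvanishingValue, Finsupp.add_apply, pow_add, Finset.prod_mul_distrib]

theorem nonvanishingValue_ne_zero (v : σ → ℂ) (b : σ →₀ ℕ) : nonvanishingValue v b ≠ 0 := by
  refine Finset.prod_ne_zero_iff.2 fun i _ => pow_ne_zero _ ?_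
  split_ifs with h
  exacts [one_ne_zero, h]

theorem aeval_monomial_one (v : σ → ℂ) (b : σ →₀ ℕ) :
    aeval v (monomial b (1 : ℂ)) = ∏ i, v i ^ b i := by
  rw [aeval_monomial, map_one, one_mul, Finsupp.prod_fintype _ _ (by simp)]

open Classical in
theorem evalPoint_invariantMonomial (v : σ → ℂ) (b : invariantExponents a) :
    (show torusInvariants a →ₐ[ℂ] ℂ from evalPoint a v) (invariantMonomial b) =
      if vanishingPart v b = 0 then nonvanishingValue v b else 0 := by
  rw [evalPoint_apply, coe_invariantMonomial, aeval_monomial_one]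
  split_ifs with h
  · rw [vanishingPart_eq_zero_iff] at h
    refine Finset.prod_congr rfl fun i _ => ?_
    split_ifs with hv
    · have : (b : σ →₀ ℕ) i = 0 := by
        by_contra hb
        exact h (Finsupp.mem_support_iff.2 hb) hv
      simp [this]
    · rfl
  · rw [vanishingPart_eq_zero_iff, Set.not_subset] at h
    obtain ⟨i, hi, hv⟩ := h
    simp only [Set.mem_ofPred_eq, not_not] at hv
    exact Finset.prod_eq_zero (Finset.mem_univ i)
      (by rw [hv, zero_pow (Finsupp.mem_support_iff.1 hi)])

/-- A criterion for singularity: enough irreducible exponents transverse to the orbit, and enough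
invariant monomials along it. -/
theorem evalPoint_mem_singularLocus [Nonempty σ] {v : σ → ℂ}
    (hdim : ringKrullDim (torusInvariants a) ≤ (Fintype.card σ - 1 : ℕ))
    (K : Set σ) (E : σ → σ →₀ ℕ) (hinj : Set.InjOn E Kᶜ)
    (hirr : ∀ j ∉ K, E j ≠ 0 ∧ ∀ b ∈ invariantExponents a, ∀ b' ∈ invariantExponents a,
      vanishingPart v b + vanishingPart v b' = E j → vanishingPart v b = 0 ∨ vanishingPart v b' = 0)
    (hatt : ∀ j ∉ K, ∃ b ∈ invariantExponents a, vanishingPart v b = E j)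
    (hlin : ∀ c : σ → ℂ, (∀ i ∉ K, c i = 0) → (∀ b ∈ invariantExponents a, vanishingPart v b = 0 →
      ∑ i, c i * b i = 0) → c = 0) :
    evalPoint a v ∈ singularLocus (torusInvariants a) := by
  classical
  by_contra hreg
  -- For `j` in `K` this is X_j ∂_j at `v`. Otherwise it reads off the monomials with vanishing part
  -- exactly `E j`; the Leibniz rule holds because `E j` is not the sum of two nonzero vanishing
  -- parts of invariants.
  let D (j : σ) : torusInvariants a →ₗ[ℂ] ℂ := monomialFunctional a fun b =>
    if j ∈ K then (if vanishingPart v b = 0 then b j * nonvanishingValue v b else 0)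
    else if vanishingPart v b = E j then nonvanishingValue v b else 0
  have hD (j : σ) (f g : torusInvariants a) : D j (f * g) =
      (show torusInvariants a →ₐ[ℂ] ℂ from evalPoint a v) f * D j g +
        D j f * (show torusInvariants a →ₐ[ℂ] ℂ from evalPoint a v) g := by
    refine isPointDerivation_of_monomials (fun b b' => ?_) f g
    rw [← invariantMonomial_add, evalPoint_invariantMonomial, evalPoint_invariantMonomial]
    simp only [D, monomialFunctional_invariantMonomial, AddSubmonoid.coe_add, vanishingPart_add,
      nonvanishingValue_add]
    by_cases hj : j ∈ K
    · simp only [hj, if_true, add_eq_zero, Finsupp.add_apply]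
      by_cases h1 : vanishingPart v b = 0 <;> by_cases h2 : vanishingPart v b' = 0 <;>
        simp [h1, h2]
      ring
    · obtain ⟨h0, hE⟩ := hirr j hj
      simp only [hj, if_false]
      by_cases h1 : vanishingPart v b = 0
      · by_cases h2 : vanishingPart v b' = 0
        · simp [h1, h2, h0.symm]
        · simp [h1, h2, h0.symm]
      · by_cases h2 : vanishingPart v b' = 0
        · simp [h1, h2, h0.symm]
        · have : vanishingPart v b + vanishingPart v b' ≠ E j := fun h =>
            (hE b b.2 b' b'.2 h).elim h1 h2
          simp [h1, h2, this]
  have hli : LinearIndependent ℂ D := by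
    rw [Fintype.linearIndependent_iff]
    intro c hc
    have happ (b : invariantExponents a) : ∑ j, c j * D j (invariantMonomial b) = 0 := by
      simpa using LinearMap.congr_fun hc (invariantMonomial b)
    -- Among the functionals, only `D j` sees a monomial with vanishing part `E j`: those indexed by
    -- `K` need vanishing part zero, and `E` is injective on the others.
    have hc0 (j : σ) (hj : j ∉ K) : c j = 0 := by
      obtain ⟨b, hb, hbE⟩ := hatt j hj
      have h0 := (hirr j hj).1
      have := happ ⟨b, hb⟩
      rw [Finset.sum_eq_single_of_mem j (Finset.mem_univ j)] at this
      · simpa [D, hj, hbE, nonvanishingValue_ne_zero] using this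
      · intro l _ hl
        by_cases hlK : l ∈ K
        · simp [D, hlK, hbE, h0]
        · have : E j ≠ E l := fun h => hl (hinj hlK hj h.symm)
          simp [D, hlK, hbE, this]
    refine congrFun (hlin c hc0 fun b hb hb0 => ?_)
    have := happ ⟨b, hb⟩
    have h1 : ∑ j, c j * D j (invariantMonomial ⟨b, hb⟩) =
        (∑ j, c j * b j) * nonvanishingValue v b := by
      rw [Finset.sum_mul]
      refine Finset.sum_congr rfl fun j _ => ?_
      by_cases hj : j ∈ K
      · simp [D, hj, hb0, mul_assoc]
      · simp [hc0 j hj]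
    rw [h1] at this
    exact (mul_eq_zero.1 this).resolve_right (nonvanishingValue_ne_zero v b)
  have := card_le_of_notMem_singularLocus (A := torusInvariants a) hreg hdim D hD hli
  have hpos := Fintype.card_pos (α := σ)
  omega

end Derivations

end GITQuotient

end

noncomputable section

namespace GITQuotient

open MvPolynomial

/-! ### Singularity at points with nontrivial stabilizer -/

section NonFree

variable {σ : Type*} [Fintype σ] {a : σ → ℤ}

/-- If the weights `1` and `-1` have multiplicity at least two, then the quotient is singular at
the image of every point with nontrivial stabilizer. -/
theorem evalPoint_mem_singularLocus_of_isStabilizerOrder {α₁ α₂ β₁ β₂ : σ} (hα : α₁ ≠ α₂)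
    (hβ : β₁ ≠ β₂) (hα₁ : a α₁ = 1) (hα₂ : a α₂ = 1) (hβ₁ : a β₁ = -1) (hβ₂ : a β₂ = -1)
    {v : σ → ℂ} {k : ℕ} (hk : IsStabilizerOrder a {i | v i ≠ 0} k) (hk1 : k ≠ 1) :
    evalPoint a v ∈ singularLocus (torusInvariants a) := by
  classical
  have hαβ {α β : σ} (h : a α = 1) (h' : a β = -1) : α ≠ β := by rintro rfl; omega
  have h11 := hαβ hα₁ hβ₁
  have h12 := hαβ hα₁ hβ₂
  have h21 := hαβ hα₂ hβ₁
  have h22 := hαβ hα₂ hβ₂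
  have hunit : ¬ (k : ℤ) ∣ 1 := fun h => hk1 (by
    have := Int.eq_one_of_dvd_one (by positivity) h
    exact_mod_cast this)
  have hdvd : ∀ i, v i ≠ 0 → (k : ℤ) ∣ a i := hk.1
  have hv1 {i : σ} (h : a i = 1) : v i = 0 := by
    by_contra hv
    exact hunit (h ▸ hdvd i hv)
  have hv2 {i : σ} (h : a i = -1) : v i = 0 := by
    by_contra hv
    have := hdvd i hv
    rw [h, dvd_neg] at this
    exact hunit this
  have : Nonempty σ := ⟨α₁⟩
  have hdim := ringKrullDim_torusInvariants_le (a := a) (α := α₁) (by omega)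
  have hgen (j : σ) : ∃ e : σ →₀ ℕ, j ≠ α₁ → j ≠ β₁ → e j = 1 ∧
      (∀ i, e i ≠ 0 → i = j ∨ i = α₁ ∨ i = β₁) ∧ IsIrreducibleMod a k e := by
    by_cases h : j ≠ α₁ ∧ j ≠ β₁
    · obtain ⟨e, he⟩ := exists_isIrreducibleMod k hα₁ hβ₁ h.1 h.2
      exact ⟨e, fun _ _ => he⟩
    · exact ⟨0, fun h1 h2 => absurd ⟨h1, h2⟩ h⟩
  choose G hG using hgen
  -- The four coordinates of weight 1 and -1 receive the four products X_α X_β; this is where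
  -- multiplicity two is used. Any other vanishing coordinate `j` receives an exponent containing
  -- `j` exactly once. The last branch matters only for the index `i₀` that is left out of `K` when
  -- `k ≠ 0`.
  let E (j : σ) : σ →₀ ℕ :=
    if j = α₁ then Finsupp.single α₁ 1 + Finsupp.single β₁ 1
    else if j = α₂ then Finsupp.single α₂ 1 + Finsupp.single β₁ 1
    else if j = β₁ then Finsupp.single α₁ 1 + Finsupp.single β₂ 1
    else if j = β₂ then Finsupp.single α₂ 1 + Finsupp.single β₂ 1
    else if v j = 0 then G j
    else Finsupp.single α₁ k
  have E1 : E α₁ = Finsupp.single α₁ 1 + Finsupp.single β₁ 1 := by simp [E]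
  have E2 : E α₂ = Finsupp.single α₂ 1 + Finsupp.single β₁ 1 := by simp [E, hα.symm]
  have E3 : E β₁ = Finsupp.single α₁ 1 + Finsupp.single β₂ 1 := by simp [E, h11.symm, h21.symm]
  have E4 : E β₂ = Finsupp.single α₂ 1 + Finsupp.single β₂ 1 := by
    simp [E, h12.symm, h22.symm, hβ.symm]
  -- the classification of the indices
  have hcases (j : σ) : j = α₁ ∨ j = α₂ ∨ j = β₁ ∨ j = β₂ ∨
      ((j ≠ α₁ ∧ j ≠ α₂ ∧ j ≠ β₁ ∧ j ≠ β₂) ∧ v j = 0 ∧ E j = G j) ∨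
      ((j ≠ α₁ ∧ j ≠ α₂ ∧ j ≠ β₁ ∧ j ≠ β₂) ∧ v j ≠ 0 ∧ E j = Finsupp.single α₁ k) := by
    by_cases h1 : j = α₁
    · exact Or.inl h1
    by_cases h2 : j = α₂
    · exact Or.inr (Or.inl h2)
    by_cases h3 : j = β₁
    · exact Or.inr (Or.inr (Or.inl h3))
    by_cases h4 : j = β₂
    · exact Or.inr (Or.inr (Or.inr (Or.inl h4)))
    by_cases h5 : v j = 0
    · simp [E, h1, h2, h3, h4, h5]
    · simp [E, h1, h2, h3, h4, h5]
  have hgood (j : σ) (hj : v j = 0 ∨ k ≠ 0) :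
      IsIrreducibleMod a k (E j) ∧ ∀ i, E j i ≠ 0 → v i = 0 := by
    have hsupp {α β : σ} (hα : a α = 1) (hβ : a β = -1) (i : σ)
        (hi : (Finsupp.single α 1 + Finsupp.single β 1 : σ →₀ ℕ) i ≠ 0) : v i = 0 := by
      by_cases h1 : i = α
      · exact h1 ▸ hv1 hα
      by_cases h2 : i = β
      · exact h2 ▸ hv2 hβ
      exact absurd (by simp [Ne.symm h1, Ne.symm h2]) hi
    rcases hcases j with rfl | rfl | rfl | rfl | ⟨h, hv, hE⟩ | ⟨h, hv, hE⟩
    · rw [E1]; exact ⟨isIrreducibleMod_pair hk1 hα₁ hβ₁, hsupp hα₁ hβ₁⟩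
    · rw [E2]; exact ⟨isIrreducibleMod_pair hk1 hα₂ hβ₁, hsupp hα₂ hβ₁⟩
    · rw [E3]; exact ⟨isIrreducibleMod_pair hk1 hα₁ hβ₂, hsupp hα₁ hβ₂⟩
    · rw [E4]; exact ⟨isIrreducibleMod_pair hk1 hα₂ hβ₂, hsupp hα₂ hβ₂⟩
    · rw [hE]
      obtain ⟨-, h2, h3⟩ := hG j h.1 h.2.2.1
      refine ⟨h3, fun i hi => ?_⟩
      rcases h2 i hi with rfl | rfl | rfl
      exacts [hv, hv1 hα₁, hv2 hβ₁]
    · rw [hE]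
      refine ⟨isIrreducibleMod_power (hj.resolve_left hv) hα₁, fun i hi => ?_⟩
      by_cases h1 : i = α₁
      · exact h1 ▸ hv1 hα₁
      · exact absurd (by simp [Ne.symm h1]) hi
  -- values that distinguish the exponents
  have hdist (j l : σ) (hj : v j = 0) (h : E j = E l) : j = l := by
    have hother (j : σ) (hne : j ≠ α₁ ∧ j ≠ α₂ ∧ j ≠ β₁ ∧ j ≠ β₂) (l : σ) (hl : E l j ≠ 0) :
        l = j := by
      rcases hcases l with rfl | rfl | rfl | rfl | ⟨h, hv, hE⟩ | ⟨h, hv, hE⟩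
      · exact absurd (by simp [E1, hne.1.symm, hne.2.2.1.symm]) hl
      · exact absurd (by simp [E2, hne.2.1.symm, hne.2.2.1.symm]) hl
      · exact absurd (by simp [E3, hne.1.symm, hne.2.2.2.symm]) hl
      · exact absurd (by simp [E4, hne.2.1.symm, hne.2.2.2.symm]) hl
      · rw [hE] at hl
        rcases (hG l h.1 h.2.2.1).2.1 j hl with h' | h' | h'
        exacts [h'.symm, absurd h' hne.1, absurd h' hne.2.2.1]
      · exact absurd (by simp [hE, hne.1.symm]) hl
    have hG1 (j : σ) (hne : j ≠ α₁ ∧ j ≠ α₂ ∧ j ≠ β₁ ∧ j ≠ β₂) (hE : E j = G j) : E j j = 1 := by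
      rw [hE]; exact (hG j hne.1 hne.2.2.1).1
    have e1 := DFunLike.congr_fun h α₁
    have e2 := DFunLike.congr_fun h α₂
    have e3 := DFunLike.congr_fun h β₁
    have e4 := DFunLike.congr_fun h β₂
    rcases hcases j with rfl | rfl | rfl | rfl | ⟨h', hv, hE⟩ | ⟨h', hv, hE⟩
    pick_goal 5
    · exact (hother j h' l (by rw [← h, hG1 j h' hE]; exact one_ne_zero)).symm
    pick_goal 5
    · exact absurd hj hv
    all_goals
      rcases hcases l with rfl | rfl | rfl | rfl | ⟨hl', hlv, hlE⟩ | ⟨hl', hlv, hlE⟩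
      pick_goal 5
      · exact hother l hl' _ (by rw [h, hG1 l hl' hlE]; exact one_ne_zero)
      pick_goal 5
      · simp [E1, E2, E3, E4, hlE, hα.symm, hβ, h11.symm, h12.symm, h21, h22] at e2 e3 e4
      all_goals
        first
        | rfl
        | (exfalso
           simp [E1, E2, E3, E4, hα, hα.symm, hβ, h11, h11.symm, h12, h21, h21.symm, h22] at e1 e2 e3 e4)
  have main (K : Set σ) (hK' : ∀ j ∉ K, v j = 0 ∨ k ≠ 0)
      (hone : ∀ j ∉ K, ∀ l ∉ K, v j ≠ 0 → v l ≠ 0 → j = l)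
      (hlin : ∀ c : σ → ℂ, (∀ i ∉ K, c i = 0) → (∀ b ∈ invariantExponents a,
        vanishingPart v b = 0 → ∑ i, c i * b i = 0) → c = 0) :
      evalPoint a v ∈ singularLocus (torusInvariants a) := by
    refine evalPoint_mem_singularLocus hdim K E ?_ ?_ ?_ hlin
    · intro j hj l hl h
      by_cases h1 : v j = 0
      · exact hdist j l h1 h
      by_cases h2 : v l = 0
      · exact (hdist l j h2 h.symm).symm
      exact hone j hj l hl h1 h2
    · intro j hj
      obtain ⟨⟨h0, -, hirr⟩, -⟩ := hgood j (hK' j hj)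
      exact ⟨h0, fun b hb b' hb' h => hirr _ _ (dvd_weight_vanishingPart hdvd hb)
        (dvd_weight_vanishingPart hdvd hb') h⟩
    · intro j hj
      obtain ⟨⟨-, hkE, -⟩, hv⟩ := hgood j (hK' j hj)
      obtain ⟨u, hu, hinv⟩ := hk.exists_extension hkE
      refine ⟨_, hinv, ?_⟩
      rw [vanishingPart_add, vanishingPart_eq_self hv, vanishingPart_eq_zero_iff.2 hu, add_zero]
  -- If `k = 0`, then `v` is fixed, its nonvanishing coordinates are themselves invariant, and `K`
  -- can be the whole support.
  by_cases hk0 : k = 0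
  · subst hk0
    refine main {i | v i ≠ 0} (fun j hj => Or.inl (by simpa using hj))
      (fun j hj l _ h _ => absurd h hj) fun c hc hb => ?_
    ext i
    by_cases hi : v i = 0
    · exact hc i (by simpa using hi)
    · have hai : a i = 0 := by simpa using hdvd i hi
      have := hb (Finsupp.single i 1) (by simp [mem_invariantExponents, Finsupp.weight_single, hai])
        (vanishingPart_eq_zero_iff.2 fun l hl => by
          have := Finsupp.support_single_subset hl
          rw [Finset.mem_singleton] at this
          exact this ▸ hi)
      simpa [Finsupp.single_apply] using this
  · obtain ⟨-, u, w, hu, hw, hu', hw'⟩ := hk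
    obtain ⟨i₀, hi₀, ha₀⟩ : ∃ i, v i ≠ 0 ∧ a i ≠ 0 := by
      by_contra! h
      have : (0 : ℤ) ∣ Finsupp.weight a u :=
        dvd_weight (I := {i | v i ≠ 0}) (fun i hi => by rw [h i hi]) hu
      rw [zero_dvd_iff, hu'] at this
      exact hk0 (by exact_mod_cast this)
    -- One direction of the support is lost to the orbit: a coordinate `i₀` of nonzero weight is
    -- dropped from `K`, and the exponent `k` at `α₁` takes its place.
    refine main ({i | v i ≠ 0} \ {i₀}) (fun _ _ => Or.inr hk0) ?_ fun c hc hb => ?_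
    · intro j hj l hl h1 h2
      have hj' : j = i₀ := by by_contra h; exact hj ⟨h1, h⟩
      have hl' : l = i₀ := by by_contra h; exact hl ⟨h2, h⟩
      rw [hj', hl']
    let C : (σ →₀ ℕ) → ℂ := fun b => ∑ i, c i * b i
    have Cadd (b b' : σ →₀ ℕ) : C (b + b') = C b + C b' := by
      simp [C, mul_add, Finset.sum_add_distrib]
    have Csmul (n : ℕ) (b : σ →₀ ℕ) : C (n • b) = n * C b := by
      simp only [C, Finset.mul_sum]
      exact Finset.sum_congr rfl fun i _ => by simp; ring
    have Csingle (i : σ) : C (Finsupp.single i 1) = c i := by simp [C, Finsupp.single_apply]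
    have hu0 := vanishingPart_eq_zero_iff.2 hu
    have hw0 := vanishingPart_eq_zero_iff.2 hw
    have huw : C u + C w = 0 := by
      rw [← Cadd]
      exact hb _ (by rw [mem_invariantExponents, map_add, hu', hw']; ring)
        (by rw [vanishingPart_add, hu0, hw0, add_zero])
    -- The invariant monomials on the support determine `c` only up to a multiple of the weights.
    -- The condition `c i₀ = 0` then removes this multiple.
    have hrel (i : σ) (hi : v i ≠ 0) (z : ℤ) (hz : a i = k * z) : c i + z * C w = 0 := by
      have hvs (n : ℕ) {b : σ →₀ ℕ} (h : vanishingPart v b = 0) : vanishingPart v (n • b) = 0 := by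
        rw [vanishingPart_eq_zero_iff] at h ⊢
        exact fun l hl => h (Finsupp.support_smul hl)
      have h1 := hb (Finsupp.single i 1 + z.toNat • w + (-z).toNat • u) (by
          rw [mem_invariantExponents, map_add, map_add, map_nsmul, map_nsmul, hu', hw',
            Finsupp.weight_single, one_smul, hz, nsmul_eq_mul, nsmul_eq_mul]
          have h1 : (z.toNat : ℤ) - ((-z).toNat : ℤ) = z := by omega
          linear_combination -(k : ℤ) * h1) (by
          rw [vanishingPart_add, vanishingPart_add, hvs _ hw0, hvs _ hu0, add_zero, add_zero,
            vanishingPart_eq_zero_iff]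
          intro l hl
          have := Finsupp.support_single_subset hl
          rw [Finset.mem_singleton] at this
          exact this ▸ hi)
      change C _ = 0 at h1
      rw [Cadd, Cadd, Csmul, Csmul, Csingle] at h1
      have h2 : (z.toNat : ℂ) - ((-z).toNat : ℂ) = z := by
        have h1 : (z.toNat : ℤ) - ((-z).toNat : ℤ) = z := by omega
        exact_mod_cast congrArg (Int.cast : ℤ → ℂ) h1
      linear_combination h1 - ((-z).toNat : ℂ) * huw - C w * h2
    have hCw : C w = 0 := by
      obtain ⟨z, hz⟩ := hdvd i₀ hi₀
      have h1 := hrel i₀ hi₀ z hz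
      rw [hc i₀ (fun h => h.2 rfl), zero_add] at h1
      have hz0 : z ≠ 0 := by rintro rfl; exact ha₀ (by simpa using hz)
      exact (mul_eq_zero.1 h1).resolve_left (by exact_mod_cast hz0)
    ext i
    by_cases hi : v i = 0
    · exact hc i fun h => h.1 hi
    · obtain ⟨z, hz⟩ := hdvd i hi
      simpa [hCw] using hrel i hi z hz

end NonFree

end GITQuotient

end

noncomputable section

namespace GITQuotient

open MvPolynomial

/-! ### Maximal ideals of polynomial rings -/

section PolynomialPoints

variable {σ : Type*}

theorem sub_aeval_mem_span (v : σ → ℂ) (f : MvPolynomial σ ℂ) :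
    f - C (aeval v f) ∈ Ideal.span (Set.range fun i => (X i - C (v i) : MvPolynomial σ ℂ)) := by
  induction f using MvPolynomial.induction_on with
  | C r => simp
  | add p q hp hq =>
    rw [map_add, C_add, add_sub_add_comm]
    exact Ideal.add_mem _ hp hq
  | mul_X p i hp =>
    have h : p * X i - C (aeval v (p * X i)) =
        X i * (p - C (aeval v p)) + C (aeval v p) * (X i - C (v i)) := by
      rw [map_mul, aeval_X, C_mul]; ring
    rw [h]
    exact Ideal.add_mem _ (Ideal.mul_mem_left _ _ hp)
      (Ideal.mul_mem_left _ _ (Ideal.subset_span ⟨i, rfl⟩))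

theorem ker_aeval_eq_span (v : σ → ℂ) : RingHom.ker (aeval v : MvPolynomial σ ℂ →ₐ[ℂ] ℂ) =
    Ideal.span (Set.range fun i => (X i - C (v i) : MvPolynomial σ ℂ)) := by
  apply le_antisymm
  · intro f hf
    rw [RingHom.mem_ker] at hf
    simpa [hf] using sub_aeval_mem_span v f
  · rw [Ideal.span_le]
    rintro _ ⟨i, rfl⟩
    simp [RingHom.mem_ker]

/-- Some maximal ideal attains the dimension, and translations carry any point to any other. -/
theorem height_ker_aeval [Fintype σ] (v : σ → ℂ) :
    (RingHom.ker (aeval v : MvPolynomial σ ℂ →ₐ[ℂ] ℂ)).height = Fintype.card σ := by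
  have hdim : ringKrullDim (MvPolynomial σ ℂ) = (Fintype.card σ : ℕ) := by
    rw [MvPolynomial.ringKrullDim_of_isNoetherianRing]
    simp
  have hfin : FiniteRingKrullDim (MvPolynomial σ ℂ) := by
    rw [finiteRingKrullDim_iff_ne_bot_and_top, hdim]
    exact ⟨nofun, fun h => by
      have h' : ((Fintype.card σ : ℕ∞) : WithBot ℕ∞) = ((⊤ : ℕ∞) : WithBot ℕ∞) := h
      exact ENat.natCast_ne_top _ (WithBot.coe_injective h')⟩
  obtain ⟨m, hm, hht⟩ := Ideal.exists_isMaximal_height (R := MvPolynomial σ ℂ)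
  obtain ⟨w, rfl⟩ := eq_vanishingIdeal_singleton_of_isMaximal ℂ hm
  let tr (y : σ → ℂ) : MvPolynomial σ ℂ →ₐ[ℂ] MvPolynomial σ ℂ := aeval fun i => X i + C (y i)
  let e : MvPolynomial σ ℂ ≃ₐ[ℂ] MvPolynomial σ ℂ := AlgEquiv.ofAlgHom (tr (v - w)) (tr (w - v))
    (by ext i; simp [tr]; ring) (by ext i; simp [tr]; ring)
  have hcomap : Ideal.comap (e : MvPolynomial σ ℂ ≃+* MvPolynomial σ ℂ) (vanishingIdeal ℂ {w}) =
      RingHom.ker (aeval v : MvPolynomial σ ℂ →ₐ[ℂ] ℂ) := by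
    ext f
    rw [Ideal.mem_comap, mem_vanishingIdeal_singleton_iff, RingHom.mem_ker]
    have : (aeval w : MvPolynomial σ ℂ →ₐ[ℂ] ℂ).comp (tr (v - w)) = aeval v := by
      ext i; simp [tr]
    exact (congrArg (· = 0) (AlgHom.congr_fun this f)).to_iff
  rw [← hcomap, RingEquiv.height_comap]
  rw [hdim] at hht
  exact_mod_cast hht

/-- In f = ∑ c_i (X_i - v_i), the partial derivatives at `v` are the c_i(v). When they vanish, both
factors of each term lie in the ideal. -/
theorem mem_sq_ker_aeval [Fintype σ] {v : σ → ℂ} {f : MvPolynomial σ ℂ} (hf : aeval v f = 0)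
    (hd : ∀ i, aeval v (pderiv i f) = 0) :
    f ∈ RingHom.ker (aeval v : MvPolynomial σ ℂ →ₐ[ℂ] ℂ) ^ 2 := by
  classical
  have h : f ∈ RingHom.ker (aeval v : MvPolynomial σ ℂ →ₐ[ℂ] ℂ) := hf
  rw [ker_aeval_eq_span, Ideal.mem_span_range_iff_exists_fun] at h
  obtain ⟨c, rfl⟩ := h
  refine Ideal.sum_mem _ fun i _ => ?_
  rw [pow_two]
  refine Ideal.mul_mem_mul ?_ ?_
  · have := hd i
    simp only [map_sum, Derivation.leibniz, map_add, smul_eq_mul, map_mul, map_sub, aeval_X,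
      pderiv_C, algHom_C, Algebra.algebraMap_self, RingHom.id_apply, sub_self, zero_mul, add_zero,
      pderiv_X, sub_zero] at this
    rw [Finset.sum_eq_single_of_mem i (Finset.mem_univ i)] at this
    · simpa using this
    · intro j _ hj
      simp [hj]
  · simp [RingHom.mem_ker]

end PolynomialPoints

end GITQuotient

end

noncomputable section

namespace GITQuotient

open MvPolynomial

/-! ### Regular points of the quotient by a diagonal torus action -/

section Regular

variable {σ : Type*} {a : σ → ℤ}

/-- The exponent of the invariant monomial obtained by balancing `X i`, given exponents `u` and `w`
of weights `1` and `-1`. -/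
def balancedExponent (a : σ → ℤ) (u w : σ →₀ ℕ) (i : σ) : σ →₀ ℕ :=
  Finsupp.single i 1 + (a i).toNat • w + (-a i).toNat • u

theorem balancedExponent_mem {u w : σ →₀ ℕ} (hu : Finsupp.weight a u = 1)
    (hw : Finsupp.weight a w = -1) (i : σ) : balancedExponent a u w i ∈ invariantExponents a := by
  rw [mem_invariantExponents, balancedExponent, map_add, map_add, map_nsmul, map_nsmul, hu, hw,
    Finsupp.weight_single, one_smul, nsmul_eq_mul, nsmul_eq_mul]
  omega

theorem add_mem_invariantExponents {u w : σ →₀ ℕ} (hu : Finsupp.weight a u = 1)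
    (hw : Finsupp.weight a w = -1) : u + w ∈ invariantExponents a := by
  rw [mem_invariantExponents, map_add, hu, hw]; rfl

theorem monomial_balancedExponent (u w : σ →₀ ℕ) (i : σ) :
    (monomial (balancedExponent a u w i) 1 : MvPolynomial σ ℂ) =
      X i * monomial w 1 ^ (a i).toNat * monomial u 1 ^ (-a i).toNat := by
  simp [balancedExponent, monomial_pow, monomial_mul, X]

/-- The gradient at `v` of an invariant. -/
def gradient (a : σ → ℤ) (v : σ → ℂ) : torusInvariants a →ₗ[ℂ] (σ → ℂ) :=
  LinearMap.pi fun i =>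
    (aeval v).toLinearMap ∘ₗ (pderiv i).toLinearMap ∘ₗ (torusInvariants a).val.toLinearMap

theorem gradient_apply (v : σ → ℂ) (h : torusInvariants a) (i : σ) :
    gradient a v h i = aeval v (pderiv i (h : MvPolynomial σ ℂ)) := rfl

variable [Fintype σ]

theorem aeval_monomial_ne_zero {v : σ → ℂ} {u : σ →₀ ℕ} (hu : ↑u.support ⊆ {i | v i ≠ 0}) :
    aeval v (monomial u (1 : ℂ)) ≠ 0 := by
  rw [aeval_monomial_one]
  refine Finset.prod_ne_zero_iff.2 fun i _ => ?_
  by_cases h : u i = 0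
  · simp [h]
  · exact pow_ne_zero _ (hu (Finsupp.mem_support_iff.2 h))

/-- The maximal ideal of a point with trivial stabilizer is generated by the invariants vanishing
there and one semi-invariant. -/
theorem ker_aeval_eq_sup {v : σ → ℂ} {u w : σ →₀ ℕ} (hu : ↑u.support ⊆ {i | v i ≠ 0})
    (hw : ↑w.support ⊆ {i | v i ≠ 0}) (hu1 : Finsupp.weight a u = 1)
    (hw1 : Finsupp.weight a w = -1) :
    RingHom.ker (aeval v : MvPolynomial σ ℂ →ₐ[ℂ] ℂ) =
      Ideal.map (algebraMap (torusInvariants a) (MvPolynomial σ ℂ))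
        (RingHom.ker (show torusInvariants a →ₐ[ℂ] ℂ from evalPoint a v)) ⊔
      Ideal.span {monomial u 1 - C (aeval v (monomial u (1 : ℂ)))} := by
  set Q := Ideal.map (algebraMap (torusInvariants a) (MvPolynomial σ ℂ))
        (RingHom.ker (show torusInvariants a →ₐ[ℂ] ℂ from evalPoint a v)) ⊔
      Ideal.span {monomial u 1 - C (aeval v (monomial u (1 : ℂ)))} with hQ
  apply le_antisymm
  -- Modulo `Q`, invariant monomials and X^u are constant. Hence so is X^w, as seen from X^(u+w),
  -- and then every X_i, as seen from its balanced monomial.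
  · have hinv (d : σ →₀ ℕ) (hd : d ∈ invariantExponents a) : Ideal.Quotient.mk Q (monomial d 1) =
        Ideal.Quotient.mk Q (C (aeval v (monomial d (1 : ℂ)))) := by
      rw [Ideal.Quotient.mk_eq_mk_iff_sub_mem]
      refine Ideal.mem_sup_left ?_
      have : (monomial d 1 - C (aeval v (monomial d (1 : ℂ))) : MvPolynomial σ ℂ) =
          algebraMap (torusInvariants a) (MvPolynomial σ ℂ) (invariantMonomial ⟨d, hd⟩ -
            algebraMap ℂ _ (aeval v (monomial d (1 : ℂ)))) := rfl
      rw [this]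
      refine Ideal.mem_map_of_mem _ ?_
      rw [RingHom.mem_ker, map_sub, AlgHom.commutes, evalPoint_apply]
      simp
    have hc {z : ℂ} (hz : z ≠ 0) : IsUnit (Ideal.Quotient.mk Q (C z)) :=
      ((isUnit_iff_ne_zero.2 hz).map (C : ℂ →+* MvPolynomial σ ℂ)).map _
    have hu' : Ideal.Quotient.mk Q (monomial u 1) =
        Ideal.Quotient.mk Q (C (aeval v (monomial u (1 : ℂ)))) := by
      rw [Ideal.Quotient.mk_eq_mk_iff_sub_mem]
      exact Ideal.mem_sup_right (Ideal.subset_span rfl)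
    have hu0 := aeval_monomial_ne_zero hu
    have hw0 := aeval_monomial_ne_zero hw
    have hw' : Ideal.Quotient.mk Q (monomial w 1) =
        Ideal.Quotient.mk Q (C (aeval v (monomial w (1 : ℂ)))) := by
      have h := hinv _ (add_mem_invariantExponents hu1 hw1)
      have h1 : (monomial (u + w) 1 : MvPolynomial σ ℂ) = monomial u 1 * monomial w 1 := by
        simp [monomial_mul]
      rw [h1, map_mul, map_mul, C_mul, map_mul, hu'] at h
      exact (hc hu0).mul_left_cancel h
    rw [ker_aeval_eq_span, Ideal.span_le]
    rintro _ ⟨i, rfl⟩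
    rw [SetLike.mem_coe, ← Ideal.Quotient.mk_eq_mk_iff_sub_mem]
    have h := hinv _ (balancedExponent_mem hu1 hw1 i)
    rw [monomial_balancedExponent] at h
    simp only [map_mul, map_pow, aeval_X, hu', hw'] at h
    exact ((hc hw0).pow _).mul_right_cancel (((hc hu0).pow _).mul_right_cancel h)
  · refine sup_le (Ideal.map_le_iff_le_comap.2 fun h hh => hh) ?_
    rw [Ideal.span_le, Set.singleton_subset_iff]
    simp [RingHom.mem_ker]

/-- Modulo the extension of `p`, the ideal `P` is principal by `ker_aeval_eq_sup`, so it has height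
at most one there by Krull. Thus the height drops by at most one from `P` to `p`. -/
theorem card_le_height_succ {v : σ → ℂ} {u w : σ →₀ ℕ} (hu : ↑u.support ⊆ {i | v i ≠ 0})
    (hw : ↑w.support ⊆ {i | v i ≠ 0}) (hu1 : Finsupp.weight a u = 1)
    (hw1 : Finsupp.weight a w = -1) :
    (Fintype.card σ : ℕ∞) ≤
      (RingHom.ker (show torusInvariants a →ₐ[ℂ] ℂ from evalPoint a v)).height + 1 := by
  set p := RingHom.ker (show torusInvariants a →ₐ[ℂ] ℂ from evalPoint a v)
  set P := RingHom.ker (aeval v : MvPolynomial σ ℂ →ₐ[ℂ] ℂ)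
  have hp : p.IsPrime := RingHom.ker_isPrime _
  have hP : P.IsPrime := RingHom.ker_isPrime _
  have hover : P.LiesOver p := ⟨rfl⟩
  have h := Ideal.height_le_height_add_of_liesOver p P
  rw [show P.height = Fintype.card σ from height_ker_aeval v] at h
  refine h.trans (add_le_add_right ?_ _)
  set J := Ideal.map (algebraMap (torusInvariants a) (MvPolynomial σ ℂ)) p
  have hJ : P = J ⊔ Ideal.span {monomial u 1 - C (aeval v (monomial u (1 : ℂ)))} :=
    ker_aeval_eq_sup hu hw hu1 hw1
  have hJP : J ≤ P := hJ ▸ le_sup_left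
  have hne : P.map (Ideal.Quotient.mk J) ≠ ⊤ := by
    intro htop
    apply hP.ne_top
    have := congrArg (Ideal.comap (Ideal.Quotient.mk J)) htop
    rwa [Ideal.comap_map_of_surjective _ Ideal.Quotient.mk_surjective, Ideal.comap_top,
      ← RingHom.ker_eq_comap_bot, Ideal.mk_ker, sup_eq_left.2 hJP] at this
  refine (Ideal.height_le_spanFinrank _ hne).trans ?_
  have hmap : P.map (Ideal.Quotient.mk J) = Ideal.span
      {Ideal.Quotient.mk J (monomial u 1 - C (aeval v (monomial u (1 : ℂ))))} := by
    conv_lhs => rw [hJ]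
    rw [Ideal.map_sup, Ideal.map_quotient_self, bot_sup_eq, Ideal.map_span, Set.image_singleton]
  rw [hmap]
  have := Submodule.spanFinrank_span_le_ncard_of_finite (R := MvPolynomial σ ℂ ⧸ J)
    (Set.finite_singleton
      (Ideal.Quotient.mk J (monomial u 1 - C (aeval v (monomial u (1 : ℂ))))))
  rw [Set.ncard_singleton] at this
  exact_mod_cast this

/-- The gradient of an invariant is orthogonal to the direction of the orbit. -/
theorem sum_weight_mul_gradient (v : σ → ℂ) (h : torusInvariants a) :
    ∑ i, a i * v i * gradient a v h i = 0 := by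
  let ℓ : torusInvariants a →ₗ[ℂ] ℂ :=
    ∑ i, (a i * v i : ℂ) • (LinearMap.proj i ∘ₗ gradient a v)
  -- On a monomial, X_i ∂_i multiplies by d_i, and ∑ d_i a_i = 0 for an invariant exponent.
  have : ℓ = 0 := by
    refine torusInvariants_linearMap_ext fun d => ?_
    have hd : ∑ i, ((d : σ →₀ ℕ) i : ℤ) * a i = 0 := by
      have := mem_invariantExponents.1 d.2
      rw [Finsupp.weight_apply, Finsupp.sum_fintype _ _ (by simp)] at this
      simpa using this
    have hi (i : σ) : a i * v i * gradient a v (invariantMonomial d) i =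
        (((d : σ →₀ ℕ) i * a i : ℤ) : ℂ) * aeval v (monomial (d : σ →₀ ℕ) (1 : ℂ)) := by
      have := congrArg (aeval v) (X_mul_pderiv_monomial (R := ℂ) (i := i) (m := (d : σ →₀ ℕ))
        (r := 1))
      rw [map_mul, aeval_X, map_nsmul, nsmul_eq_mul] at this
      rw [gradient_apply, coe_invariantMonomial, mul_assoc, this]
      push_cast
      ring
    simp only [ℓ, LinearMap.sum_apply, LinearMap.smul_apply, LinearMap.comp_apply,
      LinearMap.proj_apply, smul_eq_mul, hi, LinearMap.zero_apply]
    rw [← Finset.sum_mul, ← Int.cast_sum, hd]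
    simp
  simpa [ℓ] using LinearMap.congr_fun this h

end Regular

end GITQuotient

end

noncomputable section

namespace GITQuotient

open MvPolynomial

/-! ### Local slices and regularity at free points -/

section RegularPoint

variable {σ : Type*} {a : σ → ℤ}

/-- The action of `t` in coordinates. -/
def scalePoint (a : σ → ℤ) (t : ℂˣ) (v : σ → ℂ) : σ → ℂ := fun i => ((t ^ a i : ℂˣ) : ℂ) * v i

theorem scalePoint_ne_zero_iff {t : ℂˣ} {v : σ → ℂ} {i : σ} :
    scalePoint a t v i ≠ 0 ↔ v i ≠ 0 := by
  rw [scalePoint, mul_ne_zero_iff, and_iff_right (Units.ne_zero _)]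

variable (a) in
/-- The maximal ideal of the invariants that vanish at `v`. -/
def pointIdeal (v : σ → ℂ) : Ideal (torusInvariants a) :=
  (evalPoint a v).toPrimeSpectrum.asIdeal

instance (v : σ → ℂ) : (pointIdeal a v).IsPrime := (evalPoint a v).toPrimeSpectrum.2

theorem mem_pointIdeal {v : σ → ℂ} {h : torusInvariants a} :
    h ∈ pointIdeal a v ↔ aeval v (h : MvPolynomial σ ℂ) = 0 := Iff.rfl

variable [Fintype σ]

theorem aeval_scalePoint_monomial (t : ℂˣ) (v : σ → ℂ) (d : σ →₀ ℕ) :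
    aeval (scalePoint a t v) (monomial d (1 : ℂ)) =
      ((t ^ Finsupp.weight a d : ℂˣ) : ℂ) * aeval v (monomial d (1 : ℂ)) := by
  rw [aeval_monomial_one, aeval_monomial_one]
  simp only [scalePoint, mul_pow, Finset.prod_mul_distrib]
  congr 1
  rw [Finsupp.weight_apply, Finsupp.sum_fintype _ _ (by simp)]
  rw [show t ^ (∑ i, d i • a i) = ∏ i, t ^ (d i • a i) from
    map_sum (zpowersHom ℂˣ t).toAdditiveRight _ _]
  push_cast
  refine Finset.prod_congr rfl fun i _ => ?_
  rw [nsmul_eq_mul, mul_comm, zpow_mul, zpow_natCast]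

theorem evalPoint_scalePoint (t : ℂˣ) (v : σ → ℂ) :
    evalPoint a (scalePoint a t v) = evalPoint a v := by
  refine AlgHom.toLinearMap_injective (torusInvariants_linearMap_ext fun d => ?_)
  change aeval _ (monomial (d : σ →₀ ℕ) (1 : ℂ)) = aeval _ (monomial (d : σ →₀ ℕ) (1 : ℂ))
  rw [aeval_scalePoint_monomial, mem_invariantExponents.1 d.2]
  simp

theorem weight_eq_sum (d : σ →₀ ℕ) : Finsupp.weight a d = ∑ i, (d i : ℤ) * a i := by
  rw [Finsupp.weight_apply, Finsupp.sum_fintype _ _ (by simp)]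
  simp

/-- The product of the balanced generators of an invariant monomial. -/
theorem prod_monomial_balancedExponent (u w : σ →₀ ℕ) {d : σ →₀ ℕ}
    (hd : d ∈ invariantExponents a) :
    ∏ i, (monomial (balancedExponent a u w i) 1 : MvPolynomial σ ℂ) ^ d i =
      monomial d 1 * ∏ i, ((monomial (u + w) 1 : MvPolynomial σ ℂ) ^ (a i).toNat) ^ d i := by
  have hsum : ∑ i, (a i).toNat * d i = ∑ i, (-a i).toNat * d i := by
    rw [mem_invariantExponents, weight_eq_sum] at hd
    zify
    rw [← sub_eq_zero, ← Finset.sum_sub_distrib, ← hd]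
    refine Finset.sum_congr rfl fun i _ => ?_
    have : ((a i).toNat : ℤ) - ((-a i).toNat : ℤ) = a i := by omega
    rw [← sub_mul, this, mul_comm]
  have hX : ∏ i, (X i : MvPolynomial σ ℂ) ^ d i = monomial d 1 := by
    rw [monomial_eq, C_1, one_mul, Finsupp.prod_fintype _ _ (by simp)]
  have huw : (monomial (u + w) 1 : MvPolynomial σ ℂ) = monomial u 1 * monomial w 1 := by
    simp [monomial_mul]
  simp only [monomial_balancedExponent, mul_pow, Finset.prod_mul_distrib, hX, huw, ← pow_mul,
    Finset.prod_pow_eq_pow_sum, hsum]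
  ring

section LocalRing

variable {S : Type*} [CommRing S] [Algebra (torusInvariants a) S]

/-- A section of the quotient map over the local ring at the image of a point with trivial
stabilizer, normalized so that a semi-invariant of weight one takes the value one. -/
theorem exists_local_section [Algebra ℂ S] [IsScalarTower ℂ (torusInvariants a) S]
    {v : σ → ℂ} [IsLocalization.AtPrime S (pointIdeal a v)] {u w : σ →₀ ℕ} (hw : ↑w.support ⊆ {i | v i ≠ 0})
    (hu1 : Finsupp.weight a u = 1) (hw1 : Finsupp.weight a w = -1)
    (hvu : aeval v (monomial u (1 : ℂ)) = 1) :
    ∃ s : MvPolynomial σ ℂ →ₐ[ℂ] S,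
      (∀ h : torusInvariants a, s (h : MvPolynomial σ ℂ) = algebraMap _ S h) ∧
      RingHom.ker (aeval v : MvPolynomial σ ℂ →ₐ[ℂ] ℂ) ≤
        (Ideal.map (algebraMap (torusInvariants a) S) (pointIdeal a v)).comap s := by
  let g (i : σ) : torusInvariants a := invariantMonomial ⟨_, balancedExponent_mem hu1 hw1 i⟩
  let c : torusInvariants a := invariantMonomial ⟨_, add_mem_invariantExponents hu1 hw1⟩
  have hw0 := aeval_monomial_ne_zero hw
  have hxc : aeval v (c : MvPolynomial σ ℂ) = aeval v (monomial w (1 : ℂ)) := by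
    have : (c : MvPolynomial σ ℂ) = monomial u 1 * monomial w 1 := by simp [c, monomial_mul]
    rw [this, map_mul, hvu, one_mul]
  have hcp (n : ℕ) : c ^ n ∈ (pointIdeal a v).primeCompl := by
    refine fun h => ?_
    have := mem_pointIdeal.1 h
    rw [SubmonoidClass.coe_pow, map_pow, hxc] at this
    exact pow_ne_zero n hw0 this
  have hxg (i : σ) : aeval v (g i : MvPolynomial σ ℂ) =
      v i * aeval v (monomial w (1 : ℂ)) ^ (a i).toNat := by
    have : (g i : MvPolynomial σ ℂ) = _ := monomial_balancedExponent u w i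
    rw [this, map_mul, map_mul, map_pow, map_pow, hvu, one_pow, mul_one, aeval_X]
  -- On the slice X^u = 1 the function `c` equals X^w, and `g i` equals X_i times the power of X^w
  -- with exponent `(a i).toNat`; this quotient is therefore the coordinate X_i of the slice.
  let q (i : σ) : S := IsLocalization.mk' S (g i) ⟨c ^ (a i).toNat, hcp _⟩
  have hq (i : σ) : q i * algebraMap _ S (c ^ (a i).toNat) = algebraMap _ S (g i) :=
    IsLocalization.mk'_spec S (g i) ⟨c ^ (a i).toNat, hcp _⟩
  refine ⟨aeval q, fun h => ?_, ?_⟩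
  · have hlin : (aeval q).toLinearMap ∘ₗ (torusInvariants a).val.toLinearMap =
        (IsScalarTower.toAlgHom ℂ (torusInvariants a) S).toLinearMap := by
      refine torusInvariants_linearMap_ext fun d => ?_
      change aeval q (monomial (d : σ →₀ ℕ) 1) = algebraMap _ S (invariantMonomial d)
      have hprod : aeval q (monomial (d : σ →₀ ℕ) (1 : ℂ)) = ∏ i, q i ^ (d : σ →₀ ℕ) i := by
        rw [aeval_monomial, map_one, one_mul, Finsupp.prod_fintype _ _ (by simp)]
      have hunit : IsUnit (algebraMap _ S (∏ i, (c ^ (a i).toNat) ^ (d : σ →₀ ℕ) i)) := by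
        refine IsLocalization.map_units S (⟨_, ?_⟩ : (pointIdeal a v).primeCompl)
        exact Submonoid.prod_mem _ fun i _ => Submonoid.pow_mem _ (hcp _) _
      refine hunit.mul_right_cancel ?_
      rw [← map_mul, hprod, map_prod, ← Finset.prod_mul_distrib]
      have hfac (i : σ) : q i ^ (d : σ →₀ ℕ) i *
          algebraMap _ S ((c ^ (a i).toNat) ^ (d : σ →₀ ℕ) i) =
          algebraMap _ S (g i ^ (d : σ →₀ ℕ) i) := by
        rw [map_pow _ (c ^ (a i).toNat), ← mul_pow, map_pow _ (g i), hq]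
      simp only [hfac]
      rw [← map_prod]
      congr 1
      apply Subtype.ext
      have := prod_monomial_balancedExponent u w d.2
      simpa [g, c] using this
    exact LinearMap.congr_fun hlin h
  · rw [ker_aeval_eq_span, Ideal.span_le]
    rintro _ ⟨i, rfl⟩
    rw [SetLike.mem_coe, Ideal.mem_comap, map_sub, aeval_X]
    have hunit : IsUnit (algebraMap _ S (c ^ (a i).toNat)) :=
      IsLocalization.map_units S (⟨_, hcp _⟩ : (pointIdeal a v).primeCompl)
    have hmem : g i - algebraMap ℂ _ (v i) * c ^ (a i).toNat ∈ pointIdeal a v := by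
      rw [mem_pointIdeal, AddSubgroupClass.coe_sub, MulMemClass.coe_mul, map_sub, map_mul, hxg,
        SubmonoidClass.coe_pow, map_pow, hxc]
      simp
    have hC : (aeval q : MvPolynomial σ ℂ →ₐ[ℂ] S) (C (v i)) =
        algebraMap _ S (algebraMap ℂ (torusInvariants a) (v i)) :=
      (AlgHom.commutes (aeval q) (v i)).trans
        (IsScalarTower.algebraMap_apply ℂ (torusInvariants a) S _)
    rw [← Ideal.mul_unit_mem_iff_mem _ hunit, sub_mul, hC, hq, ← map_mul, ← map_sub]
    exact Ideal.mem_map_of_mem _ hmem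

/-- The gradients of the invariants at a point that is not fixed span a proper
subspace. -/
theorem finrank_map_gradient_succ_le {v : σ → ℂ} {i : σ} (hi : v i ≠ 0) (hai : a i ≠ 0)
    (M : Submodule ℂ (torusInvariants a)) :
    Module.finrank ℂ (M.map (gradient a v)) + 1 ≤ Fintype.card σ := by
  classical
  let ℓ : (σ → ℂ) →ₗ[ℂ] ℂ := ∑ i, (a i * v i : ℂ) • LinearMap.proj i
  have hWℓ : M.map (gradient a v) ≤ LinearMap.ker ℓ := by
    rintro _ ⟨h, -, rfl⟩
    simpa [ℓ] using sum_weight_mul_gradient v h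
  have hℓ : LinearMap.ker ℓ ≠ ⊤ := by
    intro h
    have h1 : Pi.single i 1 ∈ LinearMap.ker ℓ := h ▸ Submodule.mem_top
    simp [ℓ, Pi.single_apply, hi, hai] at h1
  have h1 := Submodule.finrank_lt (lt_top_iff_ne_top.2 hℓ).ne
  have h2 := Submodule.finrank_mono hWℓ
  rw [Module.finrank_fintype_fun_eq_card] at h1
  omega

/-- If invariants of vanishing order two lie in the square of the maximal ideal of the local ring,
then this maximal ideal has as many generators as there are independent gradients. -/
theorem spanFinrank_maximalIdeal_le [IsLocalRing S] [IsNoetherianRing S] {v : σ → ℂ}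
    (hmap : Ideal.map (algebraMap (torusInvariants a) S) (pointIdeal a v) =
      IsLocalRing.maximalIdeal S)
    (hsq : ∀ h ∈ pointIdeal a v, gradient a v h = 0 →
      algebraMap _ S h ∈ IsLocalRing.maximalIdeal S ^ 2) :
    (IsLocalRing.maximalIdeal S).spanFinrank ≤
      Module.finrank ℂ (((pointIdeal a v).restrictScalars ℂ).map (gradient a v)) := by
  set p := pointIdeal a v
  set m := IsLocalRing.maximalIdeal S
  set W := (p.restrictScalars ℂ).map (gradient a v)
  let b := Module.finBasis ℂ W
  have hb (j : Fin (Module.finrank ℂ W)) : ∃ h ∈ p, gradient a v h = b j := by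
    obtain ⟨h, hh, hh'⟩ := (b j).2
    exact ⟨h, hh, hh'⟩
  choose e hep heb using hb
  -- By Nakayama it suffices to generate modulo m². An element `h` of `p` is matched by a
  -- combination `h'` of the `e j` with the same gradient, and `hsq` places `h - h'` in m².
  have hgen : m ≤ Ideal.span (Set.range fun j => algebraMap _ S (e j)) := by
    refine Submodule.le_of_le_smul_of_le_jacobson_bot (I := m) (IsNoetherian.noetherian m)
      (IsLocalRing.maximalIdeal_le_jacobson _) ?_
    conv_lhs => rw [← hmap]
    rw [Ideal.map_le_iff_le_comap]
    intro h hh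
    have hW : gradient a v h ∈ W := ⟨h, hh, rfl⟩
    have hrep := congrArg Subtype.val (b.sum_repr ⟨_, hW⟩)
    set r := b.repr ⟨_, hW⟩
    rw [AddSubmonoidClass.coe_finsetSum] at hrep
    change _ = gradient a v h at hrep
    let h' : torusInvariants a := ∑ j, r j • e j
    have hh' : h' ∈ p := Ideal.sum_mem _ fun j _ => by
      rw [Algebra.smul_def]
      exact p.mul_mem_left _ (hep j)
    have h1 : algebraMap _ S (h - h') ∈ m ^ 2 := by
      refine hsq _ (p.sub_mem hh hh') ?_
      rw [map_sub, map_sum, sub_eq_zero, ← hrep]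
      simp [heb]
    have h2 : algebraMap _ S h' ∈ Ideal.span (Set.range fun j => algebraMap _ S (e j)) := by
      rw [map_sum]
      refine Ideal.sum_mem _ fun j _ => ?_
      rw [Algebra.smul_def, map_mul]
      exact Ideal.mul_mem_left _ _ (Ideal.subset_span ⟨j, rfl⟩)
    rw [Ideal.mem_comap, show h = h' + (h - h') by ring, map_add]
    refine Submodule.add_mem_sup h2 ?_
    rw [smul_eq_mul, ← pow_two]
    exact h1
  have hspan : m = Ideal.span (Set.range fun j => algebraMap _ S (e j)) := by
    refine le_antisymm hgen (Ideal.span_le.2 ?_)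
    rintro _ ⟨j, rfl⟩
    rw [SetLike.mem_coe, ← hmap]
    exact Ideal.mem_map_of_mem _ (hep j)
  rw [hspan]
  refine (Submodule.spanFinrank_span_le_ncard_of_finite (Set.finite_range _)).trans ?_
  rw [← Set.image_univ]
  refine (Set.ncard_image_le Set.finite_univ).trans ?_
  simp

end LocalRing

theorem exists_weight_ne_zero {v : σ → ℂ} {u : σ →₀ ℕ} (hu : ↑u.support ⊆ {i | v i ≠ 0})
    (hu0 : Finsupp.weight a u ≠ 0) : ∃ i, v i ≠ 0 ∧ a i ≠ 0 := by
  by_contra! h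
  have : (0 : ℤ) ∣ Finsupp.weight a u :=
    dvd_weight (I := {i | v i ≠ 0}) (fun i hi => by rw [h i hi]) hu
  exact hu0 (zero_dvd_iff.1 this)

/-- The local section is the identity on invariants and carries the square of the ideal of `v` into
m², which verifies the hypothesis of `spanFinrank_maximalIdeal_le`. The gradients span at most |σ| -
1 dimensions, and the height is at least that large. -/
theorem isRegularLocalRing_of_eq_one {S : Type*} [CommRing S] [IsLocalRing S] [IsNoetherianRing S]
    [Algebra (torusInvariants a) S] [Algebra ℂ S] [IsScalarTower ℂ (torusInvariants a) S]
    {v : σ → ℂ} [IsLocalization.AtPrime S (pointIdeal a v)] {u w : σ →₀ ℕ}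
    (hu : ↑u.support ⊆ {i | v i ≠ 0}) (hw : ↑w.support ⊆ {i | v i ≠ 0})
    (hu1 : Finsupp.weight a u = 1) (hw1 : Finsupp.weight a w = -1)
    (hvu : aeval v (monomial u (1 : ℂ)) = 1) : IsRegularLocalRing S := by
  refine IsRegularLocalRing.of_spanFinrank_maximalIdeal_le _ ?_
  rw [IsLocalization.AtPrime.ringKrullDim_eq_height (pointIdeal a v) S]
  have hmap := IsLocalization.AtPrime.map_eq_maximalIdeal (pointIdeal a v) S
  obtain ⟨s, hs, hsP⟩ := exists_local_section (S := S) hw hu1 hw1 hvu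
  rw [hmap] at hsP
  have hsq : ∀ h ∈ pointIdeal a v, gradient a v h = 0 →
      algebraMap _ S h ∈ IsLocalRing.maximalIdeal S ^ 2 := by
    intro h h0 h1
    have h2 : (h : MvPolynomial σ ℂ) ∈ RingHom.ker (aeval v : MvPolynomial σ ℂ →ₐ[ℂ] ℂ) ^ 2 :=
      mem_sq_ker_aeval (mem_pointIdeal.1 h0) fun i => congrFun h1 i
    rw [← hs]
    exact Ideal.le_comap_pow _ 2 (Ideal.pow_right_mono hsP 2 h2)
  have hfr := spanFinrank_maximalIdeal_le hmap hsq
  obtain ⟨i, hi, hai⟩ := exists_weight_ne_zero hu (by rw [hu1]; exact one_ne_zero)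
  have hWdim := finrank_map_gradient_succ_le hi hai ((pointIdeal a v).restrictScalars ℂ)
  have hht : (Fintype.card σ : ℕ∞) ≤ (pointIdeal a v).height + 1 :=
    card_le_height_succ hu hw hu1 hw1
  generalize (pointIdeal a v).height = H at hht ⊢
  generalize (IsLocalRing.maximalIdeal S).spanFinrank = n at hfr ⊢
  have h0 : n + 1 ≤ Fintype.card σ := by omega
  have h1 : ((n : ℕ∞) + 1) ≤ H + 1 := le_trans (by exact_mod_cast h0) hht
  have h2 := (ENat.add_le_add_iff_right ENat.one_ne_top).1 h1
  exact_mod_cast h2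

theorem evalPoint_notMem_singularLocus_of_eq_one {v : σ → ℂ} {u w : σ →₀ ℕ}
    (hu : ↑u.support ⊆ {i | v i ≠ 0}) (hw : ↑w.support ⊆ {i | v i ≠ 0})
    (hu1 : Finsupp.weight a u = 1) (hw1 : Finsupp.weight a w = -1)
    (hvu : aeval v (monomial u (1 : ℂ)) = 1) :
    evalPoint a v ∉ singularLocus (torusInvariants a) := fun hsing =>
  hsing (isRegularLocalRing_of_eq_one (S := Localization.AtPrime (pointIdeal a v))
    hu hw hu1 hw1 hvu)

/-- The quotient is regular at the image of a point with trivial stabilizer and closed orbit. -/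
theorem evalPoint_notMem_singularLocus {v : σ → ℂ}
    (h : IsStabilizerOrder a {i | v i ≠ 0} 1) :
    evalPoint a v ∉ singularLocus (torusInvariants a) := by
  obtain ⟨-, u, w, hu, hw, hu1, hw1⟩ := h
  -- Moving `v` along its orbit normalizes X^u to the value one without changing the image.
  let t : ℂˣ := (Units.mk0 _ (aeval_monomial_ne_zero hu))⁻¹
  have hsupp : {i | scalePoint a t v i ≠ 0} = {i | v i ≠ 0} :=
    Set.ext fun i => scalePoint_ne_zero_iff
  rw [← evalPoint_scalePoint t v]
  refine evalPoint_notMem_singularLocus_of_eq_one (u := u) (w := w) (hsupp ▸ hu) (hsupp ▸ hw)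
    (by simpa using hu1) (by simpa using hw1) ?_
  rw [aeval_scalePoint_monomial, show Finsupp.weight a u = 1 by simpa using hu1, zpow_one]
  rw [Units.val_inv_eq_inv_val, Units.val_mk0]
  exact inv_mul_cancel₀ (aeval_monomial_ne_zero hu)

end RegularPoint

end GITQuotient

end

noncomputable section

namespace GITQuotient

open MvPolynomial

/-! ### The Euclidean topology on complex points -/

section EuclideanTopology

variable {A : Type*} [CommRing A] [Algebra ℂ A]

/-- The value of a regular function at a complex point. -/
def ComplexPoints.eval (h : A) (x : ComplexPoints A) : ℂ := (show A →ₐ[ℂ] ℂ from x) h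

theorem ComplexPoints.continuous_eval (h : A) :
    Continuous (ComplexPoints.eval h : ComplexPoints A → ℂ) :=
  (continuous_apply h).comp continuous_induced_dom

theorem ComplexPoints.continuous_iff {X : Type*} [TopologicalSpace X] {f : X → ComplexPoints A} :
    Continuous f ↔ ∀ h : A, Continuous fun x => (f x).eval h :=
  continuous_induced_rng.trans continuous_pi_iff

/-- The Euclidean topology is determined by the functions in a spanning set. -/
theorem ComplexPoints.isInducing_of_span_eq_top {ι : Type*} {m : ι → A}
    (hm : Submodule.span ℂ (Set.range m) = ⊤) :
    Topology.IsInducing fun (x : ComplexPoints A) (i : ι) => x.eval (m i) := by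
  refine ⟨le_antisymm ?_ ?_⟩
  · exact (continuous_pi fun i => continuous_eval (m i)).le_induced
  · change _ ≤ TopologicalSpace.induced (fun (x : ComplexPoints A) (h : A) => x.eval h) _
    rw [← continuous_iff_le_induced]
    refine @continuous_pi _ _ _ (_) _ _ fun h => ?_
    have hh : h ∈ Submodule.span ℂ (Set.range m) := hm ▸ Submodule.mem_top
    let _ : TopologicalSpace (ComplexPoints A) :=
      TopologicalSpace.induced (fun (x : ComplexPoints A) (i : ι) => x.eval (m i)) inferInstance
    induction hh using Submodule.span_induction with
    | mem x hx =>
      obtain ⟨i, rfl⟩ := hx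
      have hi : Continuous fun f : ι → ℂ => f i := continuous_apply i
      exact hi.comp (continuous_induced_dom (t := Pi.topologicalSpace)
        (f := fun (x : ComplexPoints A) (i : ι) => x.eval (m i)))
    | zero =>
      convert continuous_const (y := (0 : ℂ)) using 2 with x
      exact map_zero (show A →ₐ[ℂ] ℂ from x)
    | add x y _ _ hx hy =>
      convert hx.add hy using 2 with z
      exact map_add (show A →ₐ[ℂ] ℂ from z) x y
    | smul r x _ hx =>
      convert hx.const_smul r using 2 with z
      exact map_smul (show A →ₐ[ℂ] ℂ from z) r x

/-- A neighbourhood of a point contains a polydisc with respect to any spanning set of functions. -/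
theorem ComplexPoints.exists_polydisc_subset {ι : Type*} {m : ι → A}
    (hm : Submodule.span ℂ (Set.range m) = ⊤) {x₀ : ComplexPoints A} {U : Set (ComplexPoints A)}
    (hU : U ∈ nhds x₀) :
    ∃ (F : Set ι) (ε : ι → ℝ), F.Finite ∧ (∀ i, 0 < ε i) ∧
      {x : ComplexPoints A | ∀ i ∈ F, ‖x.eval (m i) - x₀.eval (m i)‖ < ε i} ⊆ U := by
  rw [(isInducing_of_span_eq_top hm).nhds_eq_comap, nhds_pi, Filter.mem_comap] at hU
  obtain ⟨V, hV, hVU⟩ := hU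
  obtain ⟨F, hF, t, ht, htV⟩ := Filter.mem_pi.1 hV
  choose ε hε hεt using fun i => Metric.mem_nhds_iff.1 (ht i)
  refine ⟨F, ε, hF, hε, fun x hx => hVU (htV fun i hi => hεt i ?_)⟩
  rw [mem_ball_iff_norm]
  exact hx i hi

end EuclideanTopology

/-! ### The free locus as a family of orbits over the quotient -/

section Orbits

variable {σ : Type*} {a : σ → ℤ}

theorem eval_evalPoint (h : torusInvariants a) (v : σ → ℂ) :
    (evalPoint a v).eval h = aeval v (h : MvPolynomial σ ℂ) := rfl

theorem continuous_evalPoint : Continuous (evalPoint a) := by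
  refine ComplexPoints.continuous_iff.2 fun h => ?_
  simp only [eval_evalPoint, aeval_eq_eval]
  exact MvPolynomial.continuous_eval _

/-- The polynomial map that is a section of the quotient map up to the action, over the locus where
a given product of semi-invariants of weights `1` and `-1` does not vanish. -/
def orbitSection {u w : σ →₀ ℕ} (hu : Finsupp.weight a u = 1) (hw : Finsupp.weight a w = -1)
    (x : ComplexPoints (torusInvariants a)) : σ → ℂ := fun i =>
  x.eval (invariantMonomial ⟨_, balancedExponent_mem hu hw i⟩) /
    x.eval (invariantMonomial ⟨_, add_mem_invariantExponents hu hw⟩) ^ (a i).toNat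

/-- The section returns the point of the orbit of `v` with X^u = 1. Since X^u has weight one, this
point is reached by the scalar `τ⁻¹`. -/
theorem orbitSection_evalPoint {u w : σ →₀ ℕ} (hu : Finsupp.weight a u = 1)
    (hw : Finsupp.weight a w = -1) {v : σ → ℂ} {τ : ℂˣ}
    (hτ : aeval v (monomial u (1 : ℂ)) = τ) (hvw : aeval v (monomial w (1 : ℂ)) ≠ 0) :
    orbitSection hu hw (evalPoint a v) = scalePoint a τ⁻¹ v := by
  funext i
  have hc : (monomial (u + w) 1 : MvPolynomial σ ℂ) = monomial u 1 * monomial w 1 := by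
    simp [monomial_mul]
  simp only [orbitSection, eval_evalPoint, coe_invariantMonomial, scalePoint, hc,
    monomial_balancedExponent, map_mul, map_pow, aeval_X, hτ]
  rw [div_eq_iff (pow_ne_zero _ (mul_ne_zero τ.ne_zero hvw)), mul_pow]
  have : (τ : ℂ) ^ (-a i).toNat = ((τ⁻¹ ^ a i : ℂˣ) : ℂ) * (τ : ℂ) ^ (a i).toNat := by
    have h : τ ^ (-a i).toNat = τ⁻¹ ^ a i * τ ^ (a i).toNat := by
      rw [← zpow_natCast, ← zpow_natCast, inv_zpow, ← zpow_neg, ← zpow_add]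
      congr 1
      omega
    exact_mod_cast congrArg Units.val h
  rw [this]
  ring

theorem scalePoint_scalePoint (s t : ℂˣ) (v : σ → ℂ) :
    scalePoint a s (scalePoint a t v) = scalePoint a (s * t) v := by
  funext i
  simp only [scalePoint, mul_zpow, Units.val_mul]
  ring

theorem scalePoint_one (v : σ → ℂ) : scalePoint a 1 v = v := by
  funext i
  simp [scalePoint]

theorem continuous_scalePoint (t : ℂˣ) : Continuous (scalePoint a t) :=
  continuous_pi fun i => continuous_const.mul (continuous_apply i)

theorem continuousOn_orbitSection {u w : σ →₀ ℕ} (hu : Finsupp.weight a u = 1)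
    (hw : Finsupp.weight a w = -1) :
    ContinuousOn (orbitSection hu hw)
      {x | x.eval (invariantMonomial ⟨_, add_mem_invariantExponents hu hw⟩) ≠ 0} := by
  refine continuousOn_pi.2 fun i => ContinuousOn.div ?_ ?_ fun x hx => pow_ne_zero _ hx
  · exact (ComplexPoints.continuous_eval _).continuousOn
  · exact ((ComplexPoints.continuous_eval _).pow _).continuousOn

/-- The points with trivial stabilizer and closed orbit. -/
def freeLocus (a : σ → ℤ) : Set (σ → ℂ) := {v | IsStabilizerOrder a {i | v i ≠ 0} 1}

theorem scalePoint_mem_freeLocus {t : ℂˣ} {v : σ → ℂ} (hv : v ∈ freeLocus a) :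
    scalePoint a t v ∈ freeLocus a := by
  have hsupp : {i | scalePoint a t v i ≠ 0} = {i | v i ≠ 0} :=
    Set.ext fun i => scalePoint_ne_zero_iff
  change IsStabilizerOrder a {i | scalePoint a t v i ≠ 0} 1
  rwa [hsupp]

theorem eval_add_ne_zero_iff {u w : σ →₀ ℕ} (hu : Finsupp.weight a u = 1)
    (hw : Finsupp.weight a w = -1) {v : σ → ℂ} :
    (evalPoint a v).eval (invariantMonomial ⟨_, add_mem_invariantExponents hu hw⟩) ≠ 0 ↔
      aeval v (monomial u (1 : ℂ)) ≠ 0 ∧ aeval v (monomial w (1 : ℂ)) ≠ 0 := by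
  rw [eval_evalPoint, coe_invariantMonomial]
  have hc : (monomial (u + w) 1 : MvPolynomial σ ℂ) = monomial u 1 * monomial w 1 := by
    simp [monomial_mul]
  rw [hc, map_mul, mul_ne_zero_iff]

variable [Fintype σ]

theorem exists_semiinvariants {v : σ → ℂ} (hv : v ∈ freeLocus a) :
    ∃ u w : σ →₀ ℕ, Finsupp.weight a u = 1 ∧ Finsupp.weight a w = -1 ∧
      aeval v (monomial u (1 : ℂ)) ≠ 0 ∧ aeval v (monomial w (1 : ℂ)) ≠ 0 := by
  obtain ⟨-, u, w, hu, hw, hu1, hw1⟩ := hv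
  exact ⟨u, w, by simpa using hu1, by simpa using hw1, aeval_monomial_ne_zero hu,
    aeval_monomial_ne_zero hw⟩

/-- The restriction of the quotient map to free points over a given set of regular points. -/
def freeQuotientMap {U R : Set (ComplexPoints (torusInvariants a))}
    (hR : ∀ v ∈ freeLocus a, evalPoint a v ∉ R) :
    ↥(evalPoint a ⁻¹' U ∩ freeLocus a) → ↥(U \ R) :=
  fun v => ⟨evalPoint a v, v.2.1, hR _ v.2.2⟩

/-- If the free points over `U` form a simply connected space, then so does its quotient by the
connected group `ℂˣ`. -/
theorem simplyConnectedSpace_diff {U R : Set (ComplexPoints (torusInvariants a))}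
    (hR : ∀ v ∈ freeLocus a, evalPoint a v ∉ R)
    (hsurj : ∀ x ∉ R, ∃ v ∈ freeLocus a, evalPoint a v = x)
    [SimplyConnectedSpace ↥(evalPoint a ⁻¹' U ∩ freeLocus a)] :
    SimplyConnectedSpace ↥(U \ R) := by
  have hscale (t : ℂˣ) {v : σ → ℂ} (hv : v ∈ evalPoint a ⁻¹' U ∩ freeLocus a) :
      scalePoint a t v ∈ evalPoint a ⁻¹' U ∩ freeLocus a := by
    refine ⟨?_, scalePoint_mem_freeLocus hv.2⟩
    rw [Set.mem_preimage, evalPoint_scalePoint]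
    exact hv.1
  have hlift (y : ↥(U \ R)) : ∃ v ∈ evalPoint a ⁻¹' U ∩ freeLocus a, evalPoint a v = y := by
    obtain ⟨v, hv, hvy⟩ := hsurj y y.2.2
    exact ⟨v, ⟨by rw [Set.mem_preimage, hvy]; exact y.2.1, hv⟩, hvy⟩
  refine SimplyConnectedSpace.of_local_sections (q := freeQuotientMap hR) ?_ ?_ ?_ ?_
  · exact (continuous_evalPoint.comp continuous_subtype_val).subtype_mk _
  · intro y
    obtain ⟨v, hv, hvy⟩ := hlift y
    exact ⟨⟨v, hv⟩, Subtype.ext hvy⟩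
  · intro b
    obtain ⟨v, hv, hvb⟩ := hlift b
    obtain ⟨u, w, hu, hw, hvu, hvw⟩ := exists_semiinvariants hv.2
    let N : Set (ComplexPoints (torusInvariants a)) :=
      {x | x.eval (invariantMonomial ⟨_, add_mem_invariantExponents hu hw⟩) ≠ 0}
    have hN : IsOpen N := isOpen_ne_fun (ComplexPoints.continuous_eval _) continuous_const
    refine ⟨Subtype.val ⁻¹' N, (hN.preimage continuous_subtype_val).mem_nhds ?_, fun e he => ?_⟩
    · rw [Set.mem_preimage, ← hvb]
      exact (eval_add_ne_zero_iff hu hw).2 ⟨hvu, hvw⟩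
    · obtain ⟨heu, hew⟩ := (eval_add_ne_zero_iff hu hw).1 he
      let τ : ℂˣ := Units.mk0 _ heu
      -- Scaling by `τ`, the value of X^u at `e`, turns the slice X^u = 1 into the slice through
      -- `e`.
      let s₀ (y : ↥(U \ R)) : σ → ℂ := scalePoint a τ (orbitSection hu hw y)
      have hs₀ (y : ↥(U \ R)) (hy : (y : ComplexPoints _) ∈ N) :
          s₀ y ∈ evalPoint a ⁻¹' U ∩ freeLocus a ∧ evalPoint a (s₀ y) = y := by
        obtain ⟨v', hv', hvy'⟩ := hlift y
        rw [← hvy'] at hy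
        obtain ⟨h1, h2⟩ := (eval_add_ne_zero_iff hu hw).1 hy
        have : s₀ y = scalePoint a (τ * (Units.mk0 _ h1)⁻¹) v' := by
          simp only [s₀]
          rw [← hvy', orbitSection_evalPoint hu hw (τ := Units.mk0 _ h1) rfl h2,
            scalePoint_scalePoint]
        rw [this, evalPoint_scalePoint]
        exact ⟨hscale _ hv', hvy'⟩
      classical
      let s (y : ↥(U \ R)) : ↥(evalPoint a ⁻¹' U ∩ freeLocus a) :=
        if h : s₀ y ∈ evalPoint a ⁻¹' U ∩ freeLocus a then ⟨s₀ y, h⟩ else e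
      have hs (y : ↥(U \ R)) (hy : (y : ComplexPoints _) ∈ N) : (s y : σ → ℂ) = s₀ y := by
        simp only [s]
        rw [dif_pos (hs₀ y hy).1]
      refine ⟨s, ?_, fun y hy => ?_, ?_⟩
      · rw [Topology.IsInducing.subtypeVal.continuousOn_iff]
        have h1 : ContinuousOn s₀ (Subtype.val ⁻¹' N) :=
          (continuous_scalePoint τ).comp_continuousOn
            ((continuousOn_orbitSection hu hw).comp continuous_subtype_val.continuousOn
              fun y hy => hy)
        exact h1.congr hs
      · refine Subtype.ext ?_
        change evalPoint a (s y : σ → ℂ) = y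
        rw [hs y hy, (hs₀ y hy).2]
      · refine Subtype.ext ?_
        rw [hs _ he]
        change scalePoint a τ (orbitSection hu hw (evalPoint a e)) = e
        rw [orbitSection_evalPoint hu hw (τ := τ) rfl hew, scalePoint_scalePoint, mul_inv_cancel,
          scalePoint_one]
  · intro e e' hee'
    have hee : evalPoint a (e : σ → ℂ) = evalPoint a (e' : σ → ℂ) := congrArg Subtype.val hee'
    obtain ⟨u, w, hu, hw, heu, hew⟩ := exists_semiinvariants e.2.2
    have hne := (eval_add_ne_zero_iff hu hw).2 ⟨heu, hew⟩
    rw [hee] at hne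
    obtain ⟨heu', hew'⟩ := (eval_add_ne_zero_iff hu hw).1 hne
    let τ : ℂˣ := Units.mk0 _ heu
    let τ' : ℂˣ := Units.mk0 _ heu'
    have h1 := orbitSection_evalPoint hu hw (v := e) (τ := τ) rfl hew
    have h2 := orbitSection_evalPoint hu hw (v := e') (τ := τ') rfl hew'
    -- Two free points with the same image have the same representative on the slice, so they lie on
    -- one orbit.
    have h3 : scalePoint a (τ' * τ⁻¹) (e : σ → ℂ) = e' := by
      rw [← scalePoint_scalePoint, ← h1, hee, h2, scalePoint_scalePoint, mul_inv_cancel,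
        scalePoint_one]
    -- A logarithm of the scalar yields a path in ℂˣ from 1 to it, hence a path inside the orbit.
    obtain ⟨z, hz⟩ : ∃ z : ℂ, Complex.exp z = ((τ' * τ⁻¹ : ℂˣ) : ℂ) :=
      ⟨_, Complex.exp_log (Units.ne_zero _)⟩
    let θ (r : unitInterval) : ℂˣ := Units.mk0 (Complex.exp ((r : ℝ) * z)) (Complex.exp_ne_zero _)
    have hθ (r : unitInterval) (i : σ) : ((θ r ^ a i : ℂˣ) : ℂ) =
        Complex.exp (a i * ((r : ℝ) * z)) := by
      rw [Complex.exp_int_mul, Units.val_zpow_eq_zpow_val]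
      rfl
    have hθ0 : θ 0 = 1 := by
      apply Units.ext
      simp [θ]
    have hθ1 : θ 1 = τ' * τ⁻¹ := by
      apply Units.ext
      rw [← hz]
      simp [θ]
    refine ⟨⟨⟨fun r => ⟨scalePoint a (θ r) e, hscale _ e.2⟩, ?_⟩, ?_, ?_⟩, fun r => ?_⟩
    · refine Continuous.subtype_mk (continuous_pi fun i => ?_) _
      simp only [scalePoint, hθ]
      fun_prop
    · refine Subtype.ext ?_
      change scalePoint a (θ 0) e = e
      rw [hθ0, scalePoint_one]
    · refine Subtype.ext ?_
      change scalePoint a (θ 1) e = e'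
      rw [hθ1, h3]
    · refine Subtype.ext ?_
      change evalPoint a (scalePoint a (θ r) e) = evalPoint a e
      rw [evalPoint_scalePoint]

end Orbits

end GITQuotient

end

noncomputable section

namespace GITQuotient

open MvPolynomial

/-! ### The free locus as the complement of coordinate subspaces -/

section FreeLocus

variable {σ : Type*}

/-- The vectors whose coordinates in `J` vanish. -/
def vanishingSubspace (J : Set σ) : Submodule ℂ (σ → ℂ) where
  carrier := {v | ∀ i ∈ J, v i = 0}
  zero_mem' := fun _ _ => rfl
  add_mem' := fun {v w} hv hw i hi => by simp [hv i hi, hw i hi]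
  smul_mem' := fun r v hv i hi => by simp [hv i hi]

theorem mem_vanishingSubspace {J : Set σ} {v : σ → ℂ} :
    v ∈ vanishingSubspace J ↔ ∀ i ∈ J, v i = 0 := Iff.rfl

theorem finrank_vanishingSubspace_add_two_le [Fintype σ] {J : Set σ} {i j : σ} (hij : i ≠ j)
    (hi : i ∈ J) (hj : j ∈ J) :
    Module.finrank ℂ (vanishingSubspace J) + 2 ≤ Fintype.card σ := by
  have hinj : Function.Injective ![i, j] := by
    intro x y hxy
    fin_cases x <;> fin_cases y <;> simp_all
  have hsurj := LinearMap.funLeft_surjective_of_injective ℂ ℂ ![i, j] hinj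
  have hle : vanishingSubspace J ≤ LinearMap.ker (LinearMap.funLeft ℂ ℂ ![i, j]) := by
    intro v hv
    rw [LinearMap.mem_ker]
    funext x
    fin_cases x
    · exact hv i hi
    · exact hv j hj
  have h1 := Submodule.finrank_mono hle
  have h2 := LinearMap.finrank_range_add_finrank_ker (LinearMap.funLeft ℂ ℂ ![i, j])
  rw [LinearMap.range_eq_top.2 hsurj, finrank_top, Module.finrank_fintype_fun_eq_card,
    Module.finrank_fintype_fun_eq_card, Fintype.card_fin] at h2
  omega

/-- The sets of coordinates whose vanishing forces a nontrivial stabilizer or a non-closed orbit. -/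
def criticalSets (a : σ → ℤ) : Set (Set σ) :=
  {J | J = {i | 0 < a i} ∨ J = {i | a i < 0} ∨ ∃ k : ℕ, k ≠ 1 ∧ J = {i | ¬ (k : ℤ) ∣ a i}}

variable {a : σ → ℤ}

theorem exists_pos_of_weight_pos {I : Set σ} {u : σ →₀ ℕ} (hu : ↑u.support ⊆ I)
    (hw : 0 < Finsupp.weight a u) : ∃ i ∈ I, 0 < a i := by
  by_contra! h
  rw [Finsupp.weight_apply, Finsupp.sum] at hw
  refine hw.not_ge (Finset.sum_nonpos fun i hi => ?_)
  exact smul_nonpos_of_nonneg_of_nonpos (Nat.zero_le _) (h i (hu hi))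

theorem exists_neg_of_weight_neg {I : Set σ} {u : σ →₀ ℕ} (hu : ↑u.support ⊆ I)
    (hw : Finsupp.weight a u < 0) : ∃ i ∈ I, a i < 0 := by
  by_contra! h
  rw [Finsupp.weight_apply, Finsupp.sum] at hw
  refine hw.not_ge (Finset.sum_nonneg fun i hi => ?_)
  exact smul_nonneg (Nat.zero_le _) (h i (hu hi))

/-- If nonzero coordinates of both signs occur, the stabilizer order `k` exists, and `k ≠ 1` would
force all coordinates of weight not divisible by `k` to vanish. -/
theorem mem_freeLocus_iff {v : σ → ℂ} :
    v ∈ freeLocus a ↔ ∀ J ∈ criticalSets a, v ∉ vanishingSubspace J := by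
  constructor
  · rintro ⟨-, u, w, hu, hw, hu1, hw1⟩ J (rfl | rfl | ⟨k, hk, rfl⟩) hJ
    · obtain ⟨i, hi, hai⟩ := exists_pos_of_weight_pos hu (a := a) (by rw [hu1]; simp)
      exact hi (hJ i hai)
    · obtain ⟨i, hi, hai⟩ := exists_neg_of_weight_neg hw (a := a) (by rw [hw1]; simp)
      exact hi (hJ i hai)
    · have h : (k : ℤ) ∣ Finsupp.weight a u := by
        refine dvd_weight (I := {i | v i ≠ 0}) (fun i hi => ?_) hu
        by_contra hc
        exact hi (hJ i hc)
      rw [hu1, Nat.cast_one] at h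
      exact hk (by exact_mod_cast Int.eq_one_of_dvd_one (by positivity) h)
  · intro h
    have hp := h _ (Or.inl rfl)
    have hn := h _ (Or.inr (Or.inl rfl))
    simp only [mem_vanishingSubspace, not_forall] at hp hn
    obtain ⟨i, hi, hvi⟩ := hp
    obtain ⟨j, hj, hvj⟩ := hn
    obtain ⟨k, -, hk⟩ := exists_isStabilizerOrder (a := a) (I := {i | v i ≠ 0})
      ⟨i, hvi, hi⟩ ⟨j, hvj, hj⟩
    by_cases hk1 : k = 1
    · subst hk1
      exact hk
    · refine absurd ?_ (h _ (Or.inr (Or.inr ⟨k, hk1, rfl⟩)))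
      intro l hl
      by_contra hvl
      exact hl (hk.1 l hvl)

variable [Fintype σ]

/-- The part of a vector of weight zero has the same image in the quotient, if the nonzero
coordinates of the vector do not have weights of both signs. -/
theorem evalPoint_eq_of_not_mixed {v : σ → ℂ} [DecidablePred fun i => a i = 0]
    (h : (∀ i, v i ≠ 0 → a i ≤ 0) ∨ ∀ i, v i ≠ 0 → 0 ≤ a i) :
    evalPoint a (fun i => if a i = 0 then v i else 0) = evalPoint a v := by
  refine AlgHom.toLinearMap_injective (torusInvariants_linearMap_ext fun d => ?_)
  change aeval _ (monomial (d : σ →₀ ℕ) (1 : ℂ)) = aeval _ (monomial (d : σ →₀ ℕ) (1 : ℂ))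
  rw [aeval_monomial_one, aeval_monomial_one]
  by_cases hd : ∀ i, (d : σ →₀ ℕ) i ≠ 0 → a i = 0
  · refine Finset.prod_congr rfl fun i _ => ?_
    by_cases hi : (d : σ →₀ ℕ) i = 0
    · simp [hi]
    · rw [if_pos (hd i hi)]
  · push Not at hd
    obtain ⟨i, hi, hai⟩ := hd
    rw [Finset.prod_eq_zero (Finset.mem_univ i) (by simp [hai, hi])]
    symm
    -- A monomial that is nonzero at `v` only involves nonzero coordinates of `v`, whose weights do
    -- not change sign; total weight zero then forces every term d_j a_j to vanish, contradicting
    -- the choice of `i`.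
    by_contra hne
    rw [← ne_eq, Finset.prod_ne_zero_iff] at hne
    have hv (j : σ) (hj : (d : σ →₀ ℕ) j ≠ 0) : v j ≠ 0 := fun h0 =>
      hne j (Finset.mem_univ j) (by rw [h0, zero_pow hj])
    have hsum := mem_invariantExponents.1 d.2
    rw [weight_eq_sum] at hsum
    have hterm : (d : σ →₀ ℕ) i * a i = 0 := by
      rcases h with h | h
      · refine (Finset.sum_eq_zero_iff_of_nonpos fun j _ => ?_).1 hsum i (Finset.mem_univ i)
        by_cases hj : (d : σ →₀ ℕ) j = 0
        · simp [hj]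
        · exact mul_nonpos_of_nonneg_of_nonpos (by positivity) (h j (hv j hj))
      · refine (Finset.sum_eq_zero_iff_of_nonneg fun j _ => ?_).1 hsum i (Finset.mem_univ i)
        by_cases hj : (d : σ →₀ ℕ) j = 0
        · simp [hj]
        · exact mul_nonneg (by positivity) (h j (hv j hj))
    exact mul_ne_zero (by exact_mod_cast hi) hai hterm

/-! ### The theorem in coordinates -/

section TwoPairs

variable {α₁ α₂ β₁ β₂ : σ} (hα : α₁ ≠ α₂) (hβ : β₁ ≠ β₂) (hα₁ : a α₁ = 1) (hα₂ : a α₂ = 1)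
  (hβ₁ : a β₁ = -1) (hβ₂ : a β₂ = -1)

include hα hβ hα₁ hα₂ hβ₁ hβ₂

/-- A representative with nonzero coordinates of both signs has a stabilizer order, which regularity
forces to be 1. Any other representative can be replaced by its part of weight zero, a fixed point,
whose image is singular. -/
theorem exists_mem_freeLocus_of_notMem_singularLocus {x : ComplexPoints (torusInvariants a)}
    (hx : x ∉ singularLocus (torusInvariants a)) : ∃ v ∈ freeLocus a, evalPoint a v = x := by
  classical
  obtain ⟨v, rfl⟩ := evalPoint_surjective x
  by_cases hmix : (∃ i ∈ {i | v i ≠ 0}, 0 < a i) ∧ ∃ i ∈ {i | v i ≠ 0}, a i < 0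
  · obtain ⟨k, -, hk⟩ := exists_isStabilizerOrder hmix.1 hmix.2
    by_cases hk1 : k = 1
    · subst hk1
      exact ⟨v, hk, rfl⟩
    · exact absurd (evalPoint_mem_singularLocus_of_isStabilizerOrder hα hβ hα₁ hα₂ hβ₁ hβ₂ hk hk1)
        hx
  · refine absurd ?_ hx
    have h : (∀ i, v i ≠ 0 → a i ≤ 0) ∨ ∀ i, v i ≠ 0 → 0 ≤ a i := by
      by_contra! hc
      exact hmix hc
    rw [← evalPoint_eq_of_not_mixed h]
    refine evalPoint_mem_singularLocus_of_isStabilizerOrder hα hβ hα₁ hα₂ hβ₁ hβ₂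
      (isStabilizerOrder_zero fun i hi => ?_) zero_ne_one
    by_contra hai
    exact hi (if_neg hai)

/-- Every critical set contains both `α₁` and `α₂` or both `β₁` and `β₂`, since no `k ≠ 1` divides
1. The complex codimension is therefore at least two and the real one at least four. -/
theorem finrank_vanishingSubspace_add_three_le {J : Set σ} (hJ : J ∈ criticalSets a) :
    Module.finrank ℝ ((vanishingSubspace J).restrictScalars ℝ) + 3 ≤
      Module.finrank ℝ (σ → ℂ) := by
  have h : Module.finrank ℂ (vanishingSubspace J) + 2 ≤ Fintype.card σ := by
    rcases hJ with rfl | rfl | ⟨k, hk, rfl⟩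
    · exact finrank_vanishingSubspace_add_two_le hα (by simp [hα₁]) (by simp [hα₂])
    · exact finrank_vanishingSubspace_add_two_le hβ (by simp [hβ₁]) (by simp [hβ₂])
    · have hk' : ¬ (k : ℤ) ∣ 1 := fun h =>
        hk (by exact_mod_cast Int.eq_one_of_dvd_one (by positivity) h)
      exact finrank_vanishingSubspace_add_two_le hα (by simpa [hα₁] using hk')
        (by simpa [hα₂] using hk')
  have h1 : Module.finrank ℝ ((vanishingSubspace J).restrictScalars ℝ) =
      2 * Module.finrank ℂ (vanishingSubspace J) := finrank_real_of_complex (vanishingSubspace J)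
  rw [h1, finrank_real_of_complex (σ → ℂ), Module.finrank_fintype_fun_eq_card]
  omega

theorem simplyConnectedSpace_inter_freeLocus {Ω : Set (σ → ℂ)} (hΩ : IsOpen Ω)
    (hstar : StarConvex ℝ 0 Ω) (h0 : 0 ∈ Ω) : SimplyConnectedSpace ↥(Ω ∩ freeLocus a) := by
  let L (J : criticalSets a) : Submodule ℝ (σ → ℂ) :=
    (vanishingSubspace (J : Set σ)).restrictScalars ℝ
  have heq : Ω ∩ freeLocus a = Ω \ ⋃ J, (L J : Set (σ → ℂ)) := by
    ext v
    simp only [Set.mem_inter_iff, mem_freeLocus_iff, Set.mem_sdiff, Set.mem_iUnion, not_exists,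
      Subtype.forall]
    rfl
  rw [heq]
  refine simplyConnectedSpace_starConvex_diff (fun J => ?_) hΩ hstar h0 ?_
  · exact finrank_vanishingSubspace_add_three_le hα hβ hα₁ hα₂ hβ₁ hβ₂ J.2
  · exact hΩ.sdiff (isClosed_iUnion_of_finite fun J => (L J).closed_of_finiteDimensional)

/-- The statement in coordinates: the quotient of `ℂ^σ` by the diagonal action with weights `a`. -/
theorem torusInvariants_singular_and_simplyConnected :
    evalPoint a 0 ∈ singularLocus (torusInvariants a) ∧
      ∀ U ∈ nhds (evalPoint a 0), ∃ U' ⊆ U, IsOpen U' ∧ evalPoint a 0 ∈ U' ∧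
        SimplyConnectedSpace ↥(U' \ singularLocus (torusInvariants a)) := by
  constructor
  · exact evalPoint_mem_singularLocus_of_isStabilizerOrder hα hβ hα₁ hα₂ hβ₁ hβ₂
      (isStabilizerOrder_zero fun i hi => absurd rfl hi) zero_ne_one
  · intro U hU
    obtain ⟨F, ε, hF, hε, hFU⟩ :=
      ComplexPoints.exists_polydisc_subset span_range_invariantMonomial hU
    let U' := {x : ComplexPoints (torusInvariants a) | ∀ d ∈ F,
      ‖x.eval (invariantMonomial d) - (evalPoint a 0).eval (invariantMonomial d)‖ < ε d}
    have hU' : IsOpen U' := by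
      simp only [U', Set.ofPred_forall]
      exact hF.isOpen_biInter fun d _ => isOpen_lt
        ((ComplexPoints.continuous_eval _).sub continuous_const).norm continuous_const
    refine ⟨U', hFU, hU', fun d _ => by simpa using hε d, ?_⟩
    -- Nonconstant monomials vanish at 0 and do not grow in absolute value when all coordinates are
    -- scaled by r in [0, 1].
    have hstar : StarConvex ℝ 0 (evalPoint a ⁻¹' U') := by
      rw [starConvex_zero_iff]
      intro v hv r hr0 hr1 d hd
      refine lt_of_le_of_lt ?_ (hv d hd)
      simp only [eval_evalPoint, coe_invariantMonomial, aeval_monomial_one, Pi.smul_apply,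
        Pi.zero_apply]
      by_cases hd0 : (d : σ →₀ ℕ) = 0
      · simp [hd0]
      · obtain ⟨i, hi⟩ := Finsupp.ne_iff.1 hd0
        have hz : ∏ j, (0 : ℂ) ^ (d : σ →₀ ℕ) j = 0 :=
          Finset.prod_eq_zero (Finset.mem_univ i) (zero_pow hi)
        rw [hz, sub_zero, sub_zero, norm_prod, norm_prod]
        refine Finset.prod_le_prod (fun _ _ => norm_nonneg _) fun j _ => ?_
        rw [norm_pow, norm_pow, norm_smul, Real.norm_of_nonneg hr0]
        exact pow_le_pow_left₀ (by positivity) (mul_le_of_le_one_left (norm_nonneg _) hr1) _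
    have := simplyConnectedSpace_inter_freeLocus hα hβ hα₁ hα₂ hβ₁ hβ₂
      (hU'.preimage continuous_evalPoint) hstar (fun d _ => by simpa using hε d)
    exact simplyConnectedSpace_diff (fun v hv => evalPoint_notMem_singularLocus hv)
      fun x hx => exists_mem_freeLocus_of_notMem_singularLocus hα hβ hα₁ hα₂ hβ₁ hβ₂ hx

end TwoPairs

end FreeLocus

end GITQuotient

end

noncomputable section

namespace GITQuotient

/-! ### Weight bases of algebraic representations -/

section WeightBasis

variable {V : Type*} [AddCommGroup V] [Module ℂ V]

theorem mem_weightSpace {ρ : Representation ℂ ℂˣ V} {m : ℤ} {v : V} :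
    v ∈ weightSpace ρ m ↔ ∀ t : ℂˣ, ρ t v = ((t ^ m : ℂˣ) : ℂ) • v := by
  simp [weightSpace, Submodule.mem_iInf, LinearMap.mem_eqLocus]

theorem eval₂_eq_sum (P : LaurentPolynomial ℂ) {M : Finset ℤ} (hM : P.coeff.support ⊆ M)
    (t : ℂˣ) :
    LaurentPolynomial.eval₂ (RingHom.id ℂ) t P = ∑ m ∈ M, P.coeff m * ((t ^ m : ℂˣ) : ℂ) := by
  rw [← Finsupp.sum_of_support_subset P.coeff hM (fun m c => c * ((t ^ m : ℂˣ) : ℂ)) (by simp)]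
  clear hM
  induction P using LaurentPolynomial.induction_on' with
  | add p q hp hq =>
    rw [map_add, hp, hq, AddMonoidAlgebra.coeff_add,
      Finsupp.sum_add_index' (by simp) (by simp [add_mul])]
  | C_mul_T n c =>
    rw [LaurentPolynomial.eval₂_C_mul_T, ← LaurentPolynomial.single_eq_C_mul_T,
      AddMonoidAlgebra.coeff_single, Finsupp.sum_single_index (by simp), RingHom.id_apply]

/-- The single element 2 of ℂˣ already separates all characters. -/
theorem two_zpow_injective : Function.Injective fun m : ℤ =>
    ((Units.mk0 (2 : ℂ) two_ne_zero ^ m : ℂˣ) : ℂ) := by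
  intro m n h
  simp only [Units.val_zpow_eq_zpow_val, Units.val_mk0] at h
  have h2 := congrArg norm h
  rw [norm_zpow, norm_zpow, Complex.norm_ofNat] at h2
  exact zpow_right_injective₀ (by norm_num) (by norm_num) h2

/-- The functions `t ↦ t ^ m` on `ℂˣ` are linearly independent. -/
theorem eq_zero_of_sum_zpow_eq_zero {M : Finset ℤ} {c : ℤ → ℂ}
    (h : ∀ t : ℂˣ, ∑ m ∈ M, c m * ((t ^ m : ℂˣ) : ℂ) = 0) : ∀ m ∈ M, c m = 0 := by
  let χ (m : ℤ) : ℂˣ →* ℂ := (Units.coeHom ℂ).comp (zpowGroupHom m)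
  have hχ : Function.Injective χ := fun m n hmn =>
    two_zpow_injective (DFunLike.congr_fun hmn (Units.mk0 (2 : ℂ) two_ne_zero))
  have hli := (linearIndependent_monoidHom ℂˣ ℂ).comp χ hχ
  refine linearIndependent_iff'.1 hli M c ?_
  funext t
  rw [Finset.sum_apply]
  exact h t

theorem eq_of_sum_zpow_smul_eq {M : Finset ℤ} {x y : ℤ → V}
    (h : ∀ t : ℂˣ, ∑ m ∈ M, ((t ^ m : ℂˣ) : ℂ) • x m = ∑ m ∈ M, ((t ^ m : ℂˣ) : ℂ) • y m) :
    ∀ m ∈ M, x m = y m := by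
  intro m hm
  rw [← sub_eq_zero, ← Module.forall_dual_apply_eq_zero_iff ℂ]
  intro φ
  refine eq_zero_of_sum_zpow_eq_zero (M := M) (c := fun m => φ (x m - y m)) (fun t => ?_) m hm
  have h1 := congrArg φ (h t)
  simp only [map_sum, map_smul, smul_eq_mul] at h1
  simp only [map_sub, sub_mul, Finset.sum_sub_distrib, mul_comm (φ _), h1, sub_self]

/-- Algebraicity gives ρ(t) v = ∑ t^m w_m with finitely many terms. Comparing the coefficients of
t^m in ρ(s) ρ(t) v = ρ(ts) v shows that w_m has weight m, and t = 1 writes v as the sum of the w_m.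
-/
theorem iSup_weightSpace_eq_top [FiniteDimensional ℂ V] {ρ : Representation ℂ ℂˣ V}
    (hρ : IsAlgebraicRep ρ) : ⨆ m, weightSpace ρ m = ⊤ := by
  classical
  rw [eq_top_iff]
  rintro v -
  let e := Module.finBasis ℂ V
  choose P hP using fun j => hρ (e.coord j) v
  let M : Finset ℤ := Finset.univ.biUnion fun j => (P j).coeff.support
  let w (m : ℤ) : V := ∑ j, (P j).coeff m • e j
  have hw (t : ℂˣ) : ρ t v = ∑ m ∈ M, ((t ^ m : ℂˣ) : ℂ) • w m := by
    rw [← e.sum_repr (ρ t v)]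
    have hj (j) : e.repr (ρ t v) j = ∑ m ∈ M, (P j).coeff m * ((t ^ m : ℂˣ) : ℂ) :=
      (hP j t).trans (eval₂_eq_sum _ (Finset.subset_biUnion_of_mem
        (fun j => (P j).coeff.support) (Finset.mem_univ j)) t)
    simp only [hj, w, Finset.sum_smul, Finset.smul_sum, smul_smul]
    rw [Finset.sum_comm]
    simp only [mul_comm]
  have hmem (m : ℤ) (hm : m ∈ M) : w m ∈ weightSpace ρ m := by
    rw [mem_weightSpace]
    intro s
    refine eq_of_sum_zpow_smul_eq (M := M) (x := fun m => ρ s (w m))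
      (y := fun m => ((s ^ m : ℂˣ) : ℂ) • w m) (fun t => ?_) m hm
    have h1 : ρ s (ρ t v) = ρ (t * s) v := by
      rw [mul_comm, map_mul]
      rfl
    rw [hw t, hw (t * s)] at h1
    simpa only [map_sum, map_smul, mul_zpow, Units.val_mul, mul_smul] using h1
  have hv : v = ∑ m ∈ M, w m := by
    simpa using hw 1
  rw [hv]
  exact Submodule.sum_mem _ fun m hm => Submodule.mem_iSup_of_mem m (hmem m hm)

theorem exists_weight_basis [FiniteDimensional ℂ V] {ρ : Representation ℂ ℂˣ V}
    (hρ : IsAlgebraicRep ρ) :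
    ∃ (n : ℕ) (b : Module.Basis (Fin n) ℂ V) (a : Fin n → ℤ),
      ∀ (t : ℂˣ) (i : Fin n), ρ t (b i) = ((t ^ a i : ℂˣ) : ℂ) • b i := by
  have hs : ⊤ ≤ Submodule.span ℂ (⋃ m, (weightSpace ρ m : Set V)) := by
    rw [← iSup_weightSpace_eq_top hρ, Submodule.iSup_eq_span]
  let b₀ := Module.Basis.ofSpan hs
  have : Finite _ := Module.Finite.finite_basis b₀
  obtain ⟨n, ⟨f⟩⟩ := Finite.exists_equiv_fin ((linearIndepOn_empty ℂ id).extend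
    (Set.empty_subset (⋃ m, (weightSpace ρ m : Set V))))
  let b := b₀.reindex f
  have hb (i : Fin n) : ∃ m, b i ∈ weightSpace ρ m := by
    have : b i ∈ ⋃ m, (weightSpace ρ m : Set V) := by
      rw [Module.Basis.reindex_apply]
      exact Module.Basis.ofSpan_subset hs ⟨_, rfl⟩
    simpa using this
  choose a ha using hb
  exact ⟨n, b, a, fun t i => mem_weightSpace.1 (ha i) t⟩

/-- Testing with t = 2 shows that a vector of weight `m` has nonzero coordinates only at basis
vectors of weight `m`, so there are at least two of these. -/
theorem exists_ne_of_two_le_finrank_weightSpace {σ : Type*} [Fintype σ]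
    {ρ : Representation ℂ ℂˣ V} {b : Module.Basis σ ℂ V} {a : σ → ℤ}
    (hb : ∀ (t : ℂˣ) (i : σ), ρ t (b i) = ((t ^ a i : ℂˣ) : ℂ) • b i) {m : ℤ}
    (hm : 2 ≤ Module.finrank ℂ (weightSpace ρ m)) : ∃ i j, i ≠ j ∧ a i = m ∧ a j = m := by
  classical
  have : FiniteDimensional ℂ V := b.finiteDimensional_of_finite
  have hle : weightSpace ρ m ≤
      Submodule.span ℂ (((Finset.univ.filter fun i => a i = m).image b : Finset V) : Set V) := by
    intro v hv
    let t := Units.mk0 (2 : ℂ) two_ne_zero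
    have h1 := mem_weightSpace.1 hv t
    have hcoord (i : σ) : ((t ^ a i : ℂˣ) : ℂ) * b.repr v i = ((t ^ m : ℂˣ) : ℂ) * b.repr v i := by
      have h2 : ρ t v = ∑ i, (((t ^ a i : ℂˣ) : ℂ) * b.repr v i) • b i := by
        conv_lhs => rw [← b.sum_repr v, map_sum]
        simp only [map_smul, hb, smul_smul, mul_comm]
      have h3 := congrArg (fun x => b.repr x i) (h2.symm.trans h1)
      simpa only [b.repr_sum_self, map_smul, Finsupp.smul_apply, smul_eq_mul] using h3
    rw [← b.sum_repr v]
    refine Submodule.sum_mem _ fun i _ => ?_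
    by_cases hi : a i = m
    · refine Submodule.smul_mem _ _ (Submodule.subset_span ?_)
      simpa using ⟨i, hi, rfl⟩
    · have h0 : b.repr v i = 0 := by
        by_contra hne
        exact hi (two_zpow_injective (mul_right_cancel₀ hne (hcoord i)))
      rw [h0, zero_smul]
      exact Submodule.zero_mem _
  have h1 := (Submodule.finrank_mono hle).trans (finrank_span_finset_le_card _)
  have h2 := Finset.card_image_le (s := Finset.univ.filter fun i => a i = m) (f := b)
  obtain ⟨i, hi, j, hj, hij⟩ := Finset.one_lt_card.1 (lt_of_lt_of_le one_lt_two
    (hm.trans (h1.trans h2)))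
  exact ⟨i, j, hij, by simpa using hi, by simpa using hj⟩

end WeightBasis

end GITQuotient

end

noncomputable section

namespace GITQuotient

/-! ### Invariance of the assertions under isomorphisms of algebras -/

section Transport

theorem isRegularLocalRing_atPrime_of_ringEquiv {A B : Type*} [CommRing A] [CommRing B]
    (e : A ≃+* B) {p : Ideal A} {q : Ideal B}
    [p.IsPrime] [q.IsPrime] (hpq : ∀ h, h ∈ p ↔ e h ∈ q)
    (hp : IsRegularLocalRing (Localization.AtPrime p)) :
    IsRegularLocalRing (Localization.AtPrime q) := by
  have hmap : Submonoid.map e.toMonoidHom p.primeCompl = q.primeCompl := by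
    ext h
    constructor
    · rintro ⟨x, hx, rfl⟩
      exact fun h => hx ((hpq x).2 h)
    · intro hh
      refine ⟨e.symm h, fun hx => hh ?_, e.apply_symm_apply h⟩
      simpa using (hpq _).1 hx
  exact IsRegularLocalRing.of_ringEquiv (IsLocalization.ringEquivOfRingEquiv
    (Localization.AtPrime p) (Localization.AtPrime q) e hmap)

variable {A B : Type*} [CommRing A] [Algebra ℂ A] [CommRing B] [Algebra ℂ B]

/-- Isomorphic algebras have homeomorphic spaces of complex points. -/
def ComplexPoints.homeomorph (e : A ≃ₐ[ℂ] B) : ComplexPoints B ≃ₜ ComplexPoints A where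
  toFun y := (show B →ₐ[ℂ] ℂ from y).comp (e : A →ₐ[ℂ] B)
  invFun x := (show A →ₐ[ℂ] ℂ from x).comp (e.symm : B →ₐ[ℂ] A)
  left_inv y := AlgHom.ext fun h => congrArg (show B →ₐ[ℂ] ℂ from y) (e.apply_symm_apply h)
  right_inv x := AlgHom.ext fun h => congrArg (show A →ₐ[ℂ] ℂ from x) (e.symm_apply_apply h)
  continuous_toFun := ComplexPoints.continuous_iff.2 fun h => ComplexPoints.continuous_eval (e h)
  continuous_invFun := ComplexPoints.continuous_iff.2 fun h =>
    ComplexPoints.continuous_eval (e.symm h)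

theorem homeomorph_mem_singularLocus_iff (e : A ≃ₐ[ℂ] B) (y : ComplexPoints B) :
    ComplexPoints.homeomorph e y ∈ singularLocus A ↔ y ∈ singularLocus B := by
  refine not_congr ⟨fun h => ?_, fun h => ?_⟩
  · exact isRegularLocalRing_atPrime_of_ringEquiv e.toRingEquiv (fun h => Iff.rfl) h
  · refine isRegularLocalRing_atPrime_of_ringEquiv e.symm.toRingEquiv (fun h => ?_) h
    change (show B →ₐ[ℂ] ℂ from y) h = 0 ↔ (show B →ₐ[ℂ] ℂ from y) (e (e.symm h)) = 0
    rw [e.apply_symm_apply]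

/-- The local statement about the singular locus is invariant under isomorphisms of algebras. -/
theorem exists_simplyConnected_of_algEquiv (e : A ≃ₐ[ℂ] B) {y₀ : ComplexPoints B}
    (h : ∀ U ∈ nhds y₀, ∃ U' ⊆ U, IsOpen U' ∧ y₀ ∈ U' ∧
      SimplyConnectedSpace ↥(U' \ singularLocus B)) {U : Set (ComplexPoints A)}
    (hU : U ∈ nhds (ComplexPoints.homeomorph e y₀)) :
    ∃ U' ⊆ U, IsOpen U' ∧ ComplexPoints.homeomorph e y₀ ∈ U' ∧
      IsConnected (U' \ singularLocus A) ∧ SimplyConnectedSpace ↥(U' \ singularLocus A) := by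
  let Φ := ComplexPoints.homeomorph e
  obtain ⟨U', hU', hopen, hy, hsc⟩ := h (Φ ⁻¹' U) (Φ.continuous.continuousAt hU)
  have heq : U' \ singularLocus B = Φ ⁻¹' (Φ '' U' \ singularLocus A) := by
    rw [Set.preimage_sdiff, Φ.preimage_image]
    congr 1
    ext y
    exact (homeomorph_mem_singularLocus_iff e y).symm
  have hsc' : SimplyConnectedSpace ↥(Φ '' U' \ singularLocus A) :=
    (Φ.sets heq).symm.toHomotopyEquiv.simplyConnectedSpace
  refine ⟨Φ '' U', Set.image_subset_iff.2 hU', Φ.isOpenMap _ hopen, ⟨_, hy, rfl⟩, ?_, hsc'⟩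
  rw [isConnected_iff_connectedSpace]
  infer_instance

end Transport

/-! ### Identification of the invariant ring with the weight zero polynomials -/

section Coordinates

open MvPolynomial

variable {V : Type*} [AddCommGroup V] [Module ℂ V] {σ : Type*} {ρ : Representation ℂ ℂˣ V}
  {a : σ → ℤ}

/-- The action of `t` on polynomials in coordinates of weights `a`. -/
def scaleHom (a : σ → ℤ) (t : ℂˣ) : MvPolynomial σ ℂ →ₐ[ℂ] MvPolynomial σ ℂ :=
  aeval fun i => ((t⁻¹ ^ a i : ℂˣ) : ℂ) • X i

theorem coeff_scaleHom (t : ℂˣ) (h : MvPolynomial σ ℂ) (d : σ →₀ ℕ) :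
    coeff d (scaleHom a t h) = ((t⁻¹ ^ Finsupp.weight a d : ℂˣ) : ℂ) * coeff d h := by
  classical
  have key : lcoeff ℂ d ∘ₗ (scaleHom a t).toLinearMap =
      ((t⁻¹ ^ Finsupp.weight a d : ℂˣ) : ℂ) • lcoeff ℂ d := by
    refine (basisMonomials σ ℂ).ext fun d' => ?_
    have h1 : scaleHom a t (monomial d' 1) =
        ((t⁻¹ ^ Finsupp.weight a d' : ℂˣ) : ℂ) • monomial d' 1 := by
      induction d' using Finsupp.induction_linear with
      | zero => simp
      | add f g hf hg =>
        have hfg : (monomial (f + g) 1 : MvPolynomial σ ℂ) = monomial f 1 * monomial g 1 := by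
          simp [monomial_mul]
        rw [hfg, map_mul, hf, hg, map_add, zpow_add, Units.val_mul, smul_mul_smul_comm]
      | single i n =>
        have hX : (monomial (Finsupp.single i n) 1 : MvPolynomial σ ℂ) = X i ^ n :=
          (X_pow_eq_monomial).symm
        rw [hX, map_pow, scaleHom, aeval_X, smul_pow, Finsupp.weight_apply,
          Finsupp.sum_single_index (by simp), nsmul_eq_mul, mul_comm, zpow_mul, zpow_natCast,
          Units.val_pow_eq_pow_val]
    rw [coe_basisMonomials]
    change coeff d (scaleHom a t (monomial d' 1)) = _ * coeff d (monomial d' 1)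
    rw [h1, coeff_smul, coeff_monomial, smul_eq_mul]
    split_ifs with hd
    · rw [hd]
    · simp
  exact LinearMap.congr_fun key h

theorem forall_scaleHom_eq_iff {h : MvPolynomial σ ℂ} :
    (∀ t, scaleHom a t h = h) ↔ h ∈ torusInvariants a := by
  rw [mem_torusInvariants]
  constructor
  · intro hh d hd
    -- The action is contragredient, so the parameter 2⁻¹ multiplies the coefficient at `d` by 2 to
    -- the weight of `d`.
    have h1 := congrArg (coeff d) (hh (Units.mk0 (2 : ℂ) two_ne_zero)⁻¹)
    rw [coeff_scaleHom, inv_inv] at h1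
    refine two_zpow_injective ((mul_eq_right₀ hd).1 h1 |>.trans ?_)
    simp
  · intro hh t
    ext d
    rw [coeff_scaleHom]
    by_cases hd : coeff d h = 0
    · rw [hd, mul_zero]
    · rw [hh hd]
      simp

theorem mem_invariantRing {h : SymmetricAlgebra ℂ (Module.Dual ℂ V)} :
    h ∈ invariantRing ρ ↔ ∀ t, symAction ρ t h = h := by
  simp [invariantRing, Algebra.mem_iInf]

variable [Finite σ] [DecidableEq σ]

/-- Polynomial functions on `V` in coordinates. -/
def coordinateEquiv (b : Module.Basis σ ℂ V) :
    SymmetricAlgebra ℂ (Module.Dual ℂ V) ≃ₐ[ℂ] MvPolynomial σ ℂ :=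
  SymmetricAlgebra.equivMvPolynomial b.dualBasis

theorem coordinateEquiv_ι (b : Module.Basis σ ℂ V) (i : σ) :
    coordinateEquiv b (SymmetricAlgebra.ι ℂ _ (b.dualBasis i)) = X i :=
  SymmetricAlgebra.equivMvPolynomial_ι_apply _ _

theorem dual_dualBasis {b : Module.Basis σ ℂ V}
    (hb : ∀ (t : ℂˣ) (i : σ), ρ t (b i) = ((t ^ a i : ℂˣ) : ℂ) • b i) (t : ℂˣ) (i : σ) :
    ρ.dual t (b.dualBasis i) = ((t⁻¹ ^ a i : ℂˣ) : ℂ) • b.dualBasis i := by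
  refine b.ext fun j => ?_
  change b.dualBasis i (ρ t⁻¹ (b j)) = ((t⁻¹ ^ a i : ℂˣ) : ℂ) • b.dualBasis i (b j)
  rw [hb, map_smul, Module.Basis.dualBasis_apply_self]
  by_cases h : j = i
  · rw [h]
  · simp [h]

theorem coordinateEquiv_symAction {b : Module.Basis σ ℂ V}
    (hb : ∀ (t : ℂˣ) (i : σ), ρ t (b i) = ((t ^ a i : ℂˣ) : ℂ) • b i) (t : ℂˣ)
    (h : SymmetricAlgebra ℂ (Module.Dual ℂ V)) :
    coordinateEquiv b (symAction ρ t h) = scaleHom a t (coordinateEquiv b h) := by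
  have : ((coordinateEquiv b : SymmetricAlgebra ℂ (Module.Dual ℂ V) →ₐ[ℂ] MvPolynomial σ ℂ).comp
      (symAction ρ t)) = (scaleHom a t).comp (coordinateEquiv b : _ →ₐ[ℂ] _) := by
    refine SymmetricAlgebra.algHom_ext (b.dualBasis.ext fun i => ?_)
    change coordinateEquiv b (symAction ρ t (SymmetricAlgebra.ι ℂ _ (b.dualBasis i))) =
      scaleHom a t (coordinateEquiv b (SymmetricAlgebra.ι ℂ _ (b.dualBasis i)))
    rw [symAction, SymmetricAlgebra.lift_ι_apply, LinearMap.comp_apply, dual_dualBasis hb,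
      map_smul, map_smul, coordinateEquiv_ι, scaleHom, aeval_X]
  exact DFunLike.congr_fun this h

theorem map_invariantRing {b : Module.Basis σ ℂ V}
    (hb : ∀ (t : ℂˣ) (i : σ), ρ t (b i) = ((t ^ a i : ℂˣ) : ℂ) • b i) :
    (invariantRing ρ).map (coordinateEquiv b : _ →ₐ[ℂ] MvPolynomial σ ℂ) = torusInvariants a := by
  ext h
  rw [Subalgebra.mem_map, ← forall_scaleHom_eq_iff]
  constructor
  · rintro ⟨x, hx, rfl⟩ t
    change scaleHom a t (coordinateEquiv b x) = coordinateEquiv b x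
    rw [← coordinateEquiv_symAction hb, mem_invariantRing.1 hx t]
  · intro hh
    refine ⟨(coordinateEquiv b).symm h, mem_invariantRing.2 fun t => ?_,
      (coordinateEquiv b).apply_symm_apply h⟩
    rw [← (coordinateEquiv b).injective.eq_iff, coordinateEquiv_symAction hb,
      AlgEquiv.apply_symm_apply, hh]

/-- The invariants of a representation of `ℂˣ` in coordinates. -/
def invariantRingEquiv {b : Module.Basis σ ℂ V}
    (hb : ∀ (t : ℂˣ) (i : σ), ρ t (b i) = ((t ^ a i : ℂˣ) : ℂ) • b i) :
    invariantRing ρ ≃ₐ[ℂ] torusInvariants a :=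
  ((coordinateEquiv b).subalgebraMap (invariantRing ρ)).trans
    (Subalgebra.equivOfEq _ _ (map_invariantRing hb))

theorem homeomorph_evalPoint_zero {b : Module.Basis σ ℂ V}
    (hb : ∀ (t : ℂˣ) (i : σ), ρ t (b i) = ((t ^ a i : ℂˣ) : ℂ) • b i) :
    ComplexPoints.homeomorph (invariantRingEquiv hb) (evalPoint a 0) = quotientMap ρ 0 := by
  have h : (aeval (0 : σ → ℂ)).comp (coordinateEquiv b : _ →ₐ[ℂ] MvPolynomial σ ℂ) =
      evalAt (0 : V) := by
    refine SymmetricAlgebra.algHom_ext (b.dualBasis.ext fun i => ?_)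
    change aeval (0 : σ → ℂ) (coordinateEquiv b (SymmetricAlgebra.ι ℂ _ (b.dualBasis i))) =
      evalAt (0 : V) (SymmetricAlgebra.ι ℂ _ (b.dualBasis i))
    rw [coordinateEquiv_ι, aeval_X, evalAt, SymmetricAlgebra.lift_ι_apply]
    simp
  exact AlgHom.ext fun x => DFunLike.congr_fun h (x : SymmetricAlgebra ℂ (Module.Dual ℂ V))

end Coordinates

end GITQuotient

end

/-- A weight basis turns the multiplicity hypotheses into two pairs of coordinates of weights 1 and
-1; the coordinate version then transfers along `invariantRingEquiv`. -/
theorem mainTheorem8 {V : Type*} [AddCommGroup V] [Module ℂ V] [FiniteDimensional ℂ V]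
    (ρ : Representation ℂ ℂˣ V) (hρ : GITQuotient.IsAlgebraicRep ρ)
    (hneg : 2 ≤ Module.finrank ℂ (GITQuotient.weightSpace ρ (-1)))
    (hpos : 2 ≤ Module.finrank ℂ (GITQuotient.weightSpace ρ 1)) :
    GITQuotient.quotientMap ρ 0 ∈
        GITQuotient.singularLocus (GITQuotient.invariantRing ρ) ∧
      ∀ U ∈ nhds (GITQuotient.quotientMap ρ 0),
        ∃ U' : Set (GITQuotient.AffineQuotient ρ), U' ⊆ U ∧ IsOpen U' ∧
          GITQuotient.quotientMap ρ 0 ∈ U' ∧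
          IsConnected (U' \ GITQuotient.singularLocus (GITQuotient.invariantRing ρ)) ∧
          SimplyConnectedSpace
            ↥(U' \ GITQuotient.singularLocus (GITQuotient.invariantRing ρ)) := by
  obtain ⟨n, b, a, hb⟩ := GITQuotient.exists_weight_basis hρ
  obtain ⟨α₁, α₂, hα, hα₁, hα₂⟩ := GITQuotient.exists_ne_of_two_le_finrank_weightSpace hb hpos
  obtain ⟨β₁, β₂, hβ, hβ₁, hβ₂⟩ := GITQuotient.exists_ne_of_two_le_finrank_weightSpace hb hneg
  obtain ⟨hsing, hloc⟩ := GITQuotient.torusInvariants_singular_and_simplyConnected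
    hα hβ hα₁ hα₂ hβ₁ hβ₂
  rw [← GITQuotient.homeomorph_evalPoint_zero hb]
  exact ⟨(GITQuotient.homeomorph_mem_singularLocus_iff _ _).2 hsing, fun U hU =>
    GITQuotient.exists_simplyConnected_of_algEquiv _ hloc hU⟩
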